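/- **Definitions.** A fractal string $\mathcal L$ is a bounded open set $\Omega\subset\mathbb R$ that is not a finite union of intervals; thus $\Omega=\bigcup_{j\ge 1} I_j$ is a disjoint union of infinitely many open intervals (its connected components), and we order them so that their lengths $\ell_j=|I_j|$ are nonincreasing. For $\varepsilon>0$ let $V(\varepsilon)$ be the Lebesgue measure of $\{x\in\Omega : d(x,\partial\Omega)<\varepsilon\}$, and for $d\ge 0$ put $$\mathcal M_d^*=\limsup_{\varepsilon\to0^+}\frac{V(\varepsilon)}{\varepsilon^{1-d}},\qquad \mathcal M_{*,d}=\liminf_{\varepsilon\to0^+}\frac{V(\varepsilon)}{\varepsilon^{1-d}}.$$ The Minkowski dimension of $\mathcal L$ is $D_{\mathcal L}=\inf\{d\ge0:\mathcal M_d^*<\infty\}$, and $\mathcal L$ is Minkowski measurable if $0<\mathcal M_{*,D_{\mathcal L}}=\mathcal M^*_{D_{\mathcal L}}<\infty$. The spectral counting function of $\mathcal L$ is $$N_\nu(x)=\#\{(n,j): n\ge1,\ j\ge1,\ n\,\ell_j^{-1}\le x\}$$ (the frequencies $n\,\ell_j^{-1}$ are counted with multiplicity), and its Weyl term is $W(x)=|\Omega|\,x$,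 where $|\Omega|$ is the Lebesgue measure of $\Omega$. For $D\in(0,1)$, the inverse spectral problem $(\mathrm{ISP})_D$ is said to have an affirmative answer if every fractal string $\mathcal L$ of Minkowski dimension $D$ for which there is a real constant $C\ne0$ with $$N_\nu(x)=W(x)-C\,x^D+o(x^D)\qquad(x\to+\infty)$$ is Minkowski measurable. **Theorem.** Fix $D\in(0,1)$. Then $(\mathrm{ISP})_D$ has an affirmative answer if and only if the Riemann zeta function satisfies $\zeta(s)\ne0$ for all $s\in\mathbb C$ with $\operatorname{Re}(s)=D$. -/

import Mathlib

/-- A (nontrivial) fractal string: a bounded open subset of `ℝ` which is not a finite union of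
intervals, presented as the disjoint union of its infinitely many connected components
`I j = (left j, right j)`, enumerated so that the lengths are nonincreasing. -/
structure FractalString where
  left : ℕ → ℝ
  right : ℕ → ℝ
  left_lt_right : ∀ j, left j < right j
  disjoint : ∀ i j, i ≠ j → Disjoint (Set.Ioo (left i) (right i)) (Set.Ioo (left j) (right j))
  bounded : Bornology.IsBounded (⋃ j, Set.Ioo (left j) (right j))
  antitone_length : Antitone (fun j => right j - left j)

noncomputable section

namespace FractalString

/-- The underlying bounded open set `Ω`. -/
def domain (L : FractalString) : Set ℝ := ⋃ j, Set.Ioo (L.left j) (L.right j)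

/-- The length `ℓ j` of the `j`-th interval. -/
def length (L : FractalString) (j : ℕ) : ℝ := L.right j - L.left j

/-- The inner `ε`-neighborhood of the boundary of `Ω`. -/
def innerTube (L : FractalString) (ε : ℝ) : Set ℝ :=
  {x | x ∈ L.domain ∧ Metric.infDist x (frontier L.domain) < ε}

/-- The ratio `V(ε) / ε^(1-d)`, where `V(ε)` is the Lebesgue measure of the inner tube. -/
def contentRatio (L : FractalString) (d ε : ℝ) : ENNReal :=
  MeasureTheory.volume (L.innerTube ε) / ENNReal.ofReal (ε ^ (1 - d))

/-- The `d`-dimensional upper Minkowski content, in `[0, ∞]`. -/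
def upperContent (L : FractalString) (d : ℝ) : ENNReal :=
  Filter.limsup (fun ε => L.contentRatio d ε) (nhdsWithin 0 (Set.Ioi 0))

/-- The `d`-dimensional lower Minkowski content, in `[0, ∞]`. -/
def lowerContent (L : FractalString) (d : ℝ) : ENNReal :=
  Filter.liminf (fun ε => L.contentRatio d ε) (nhdsWithin 0 (Set.Ioi 0))

/-- The Minkowski dimension. The set contains `1` and is bounded below by `0`. -/
def dimension (L : FractalString) : ℝ :=
  sInf {d : ℝ | 0 ≤ d ∧ L.upperContent d < ⊤}

/-- Minkowski measurability: the lower and upper Minkowski contents in the dimension of the string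
agree, and their common value lies in `(0, ∞)`. -/
def MinkowskiMeasurable (L : FractalString) : Prop :=
  0 < L.lowerContent L.dimension ∧ L.upperContent L.dimension < ⊤ ∧
    L.lowerContent L.dimension = L.upperContent L.dimension

/-- The spectral counting function: the number of frequencies `n / ℓ j` (`n ≥ 1`) that are at most
`x`, counted with multiplicity, that is, the number of pairs `(n, j)`. -/
def spectralCount (L : FractalString) (x : ℝ) : ℕ :=
  Set.ncard {p : ℕ × ℕ | 1 ≤ p.1 ∧ (p.1 : ℝ) * (L.length p.2)⁻¹ ≤ x}

/-- The Weyl term `W(x) = |Ω| x`. -/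
def weylTerm (L : FractalString) (x : ℝ) : ℝ :=
  (MeasureTheory.volume L.domain).toReal * x

/-- `N_ν(x) = W(x) - C x^D + o(x^D)` as `x → +∞`, for some nonzero real constant `C`. -/
def HasMonotonicSecondTerm (L : FractalString) (D : ℝ) : Prop :=
  ∃ C : ℝ, C ≠ 0 ∧
    Asymptotics.IsLittleO Filter.atTop
      (fun x : ℝ => (L.spectralCount x : ℝ) - (L.weylTerm x - C * x ^ D))
      (fun x : ℝ => x ^ D)

end FractalString

/-- The inverse spectral problem in dimension `D` has an affirmative answer for every fractal
string of Minkowski dimension `D` satisfying its assumptions. -/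
def InverseSpectralProblem (D : ℝ) : Prop :=
  ∀ L : FractalString, L.dimension = D → L.HasMonotonicSecondTerm D → L.MinkowskiMeasurable

end

noncomputable section

open Filter Asymptotics Set MeasureTheory Topology
open scoped FourierTransform SchwartzMap ContDiff

/-! Geometry and spectrum are two sums over the same lengths. An interval of length `ℓ` contributes
`min (2ε) ℓ` to the tube, so `V(ε) = 2ε ∑ⱼ min(1, xℓⱼ)` with `x = (2ε)⁻¹`. Since `y - ⌊y⌋` is the
fractional part, `W(x) - N_ν(x) = ∑ⱼ {xℓⱼ}`. Both sums are multiplicative convolutions of the point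
masses at `ℓⱼ⁻¹` with kernels, `min(1, 1/y)` and `{1/y}`, whose Mellin transforms in `0 < re s < 1`
are `1/(s(1-s))` and `-ζ(s)/s` (`mellin_min_one_inv`, `mellin_fract_inv`). The question is whether
`{xℓⱼ}`-sums asymptotic to `C x^D` force the same behaviour for the `min`-sums.

If `ζ` has no zero on `re s = D`, the quotient of the two transforms is smooth on that line. In
logarithmic scale this is a Wiener type Tauberian problem: averages of the `min`-sum against Fourier
transforms of compactly supported test functions equal averages of the fractional-part sum against
other such transforms, the quotient being absorbed in the test function
(`exists_tendsto_tsum_shift`). They therefore converge. The normalized `min`-sum is bounded and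
Lipschitz, so it is a uniform limit of its averages and converges too
(`exists_tendsto_of_tendsto_integral_fourier`).

If `ζ(s) = 0` with `re s = D`, then `s` is not real. Take lengths whose reciprocals have counting
function close to `y^D + a re(y^s)`, with `a` small enough for monotonicity. Comparing sums with
integrals, the oscillating term is multiplied by the Mellin transform at `s`. This vanishes for the
fractional-part kernel, leaving a pure second term, but not for the `min` kernel, so the tube volume
oscillates and the string is not Minkowski measurable. -/

/-! ### Mellin transforms of the two kernels. -/

theorem locallyIntegrableOn_Ioi_of_norm_le_one {f : ℝ → ℂ} (hm : Measurable f)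
    (h1 : ∀ x, 0 < x → ‖f x‖ ≤ 1) : LocallyIntegrableOn f (Ioi 0) := by
  intro x hx
  refine ⟨Ioc 0 (x + 1), ?_, ?_⟩
  · exact mem_of_superset (inter_mem_nhdsWithin _ (Iio_mem_nhds (lt_add_one x)))
      fun y hy => ⟨hy.1, hy.2.le⟩
  · refine Measure.integrableOn_of_bounded (M := 1) (by simp) hm.aestronglyMeasurable ?_
    exact (ae_restrict_iff' measurableSet_Ioc).2 (ae_of_all _ fun y hy => h1 y hy.1)

/-- Comparison with `min 1 x⁻¹` gives convergence of the Mellin transform in `0 < re s < 1`. -/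
theorem mellinConvergent_of_le_min {f : ℝ → ℝ} (hm : Measurable f)
    (h0 : ∀ x, 0 < x → 0 ≤ f x) (h1 : ∀ x, 0 < x → f x ≤ min 1 x⁻¹) {s : ℂ}
    (hs0 : 0 < s.re) (hs1 : s.re < 1) : MellinConvergent (fun x => (f x : ℂ)) s := by
  refine mellinConvergent_of_isBigO_rpow (a := 1) (b := 0) ?_ ?_ hs1 ?_ hs0
  · refine locallyIntegrableOn_Ioi_of_norm_le_one (Complex.measurable_ofReal.comp hm) fun x hx => ?_
    have := (h1 x hx).trans (min_le_left _ _)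
    simpa [abs_of_nonneg (h0 x hx)] using this
  · refine IsBigO.of_bound 1 ?_
    filter_upwards [eventually_gt_atTop 0] with x hx
    have := (h1 x hx).trans (min_le_right _ _)
    rw [Complex.norm_real, Real.norm_of_nonneg (h0 x hx), one_mul, Real.rpow_neg_one]
    exact this.trans (le_abs_self _)
  · refine IsBigO.of_bound 1 ?_
    filter_upwards [self_mem_nhdsWithin] with x hx
    have := (h1 x hx).trans (min_le_left _ _)
    simpa [abs_of_nonneg (h0 x hx)] using this

theorem setIntegral_Ioi_zero_eq_add {g : ℝ → ℂ} (hg : IntegrableOn g (Ioi 0)) :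
    ∫ t in Ioi 0, g t = (∫ t in Ioc 0 1, g t) + ∫ t in Ioi 1, g t := by
  have hd : Disjoint (Ioc (0:ℝ) 1) (Ioi 1) :=
    Set.disjoint_left.2 fun x hx hx' => absurd hx.2 (not_le.2 hx')
  rw [← Ioc_union_Ioi_eq_Ioi (zero_le_one (α := ℝ)), setIntegral_union hd measurableSet_Ioi
    (hg.mono_set Ioc_subset_Ioi_self) (hg.mono_set (Ioi_subset_Ioi zero_le_one))]

theorem setIntegral_Ioi_one_cpow_mul_inv {f : ℝ → ℝ} {s : ℂ} (hs1 : s.re < 1)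
    (hf : ∀ t, 1 < t → f t = t⁻¹) :
    ∫ t in Ioi (1:ℝ), (t : ℂ) ^ (s - 1) • (f t : ℂ) = 1 / (1 - s) := by
  have hs' : 1 - s ≠ 0 := by
    intro h
    have : s = 1 := by linear_combination -h
    simp [this] at hs1
  have : ∫ t in Ioi (1:ℝ), (t : ℂ) ^ (s - 1) • (f t : ℂ) =
      ∫ t in Ioi (1:ℝ), (t : ℂ) ^ (s - 2) := by
    refine setIntegral_congr_fun measurableSet_Ioi fun t (ht : 1 < t) => ?_
    have ht0 : (t : ℂ) ≠ 0 := by exact_mod_cast (zero_lt_one.trans ht).ne'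
    simp only [hf t ht, smul_eq_mul, Complex.ofReal_inv]
    rw [show s - 2 = (s - 1) - 1 by ring, Complex.cpow_sub (s - 1) 1 ht0, Complex.cpow_one,
      div_eq_mul_inv]
  rw [this, integral_Ioi_cpow_of_lt (by simp; linarith) zero_lt_one]
  have : s - 2 + 1 ≠ 0 := by intro h; apply hs'; linear_combination -h
  simp only [Complex.ofReal_one, Complex.one_cpow]
  field_simp
  ring

theorem mellin_min_one_inv {s : ℂ} (hs0 : 0 < s.re) (hs1 : s.re < 1) :
    mellin (fun x : ℝ => ((min 1 x⁻¹ : ℝ) : ℂ)) s = 1 / (s * (1 - s)) := by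
  have hc : MellinConvergent (fun x : ℝ => ((min 1 x⁻¹ : ℝ) : ℂ)) s :=
    mellinConvergent_of_le_min (by fun_prop) (fun x hx => by positivity) (fun x _ => le_rfl)
      hs0 hs1
  have hI := hasMellin_one_Ioc hs0
  have hs : s ≠ 0 := by rintro rfl; simp at hs0
  have hs' : 1 - s ≠ 0 := by
    intro h
    have : s = 1 := by linear_combination -h
    simp [this] at hs1
  have hc' := hc
  rw [MellinConvergent] at hc'
  rw [mellin, setIntegral_Ioi_zero_eq_add hc', setIntegral_Ioi_one_cpow_mul_inv hs1
    fun t ht => min_eq_right (inv_le_one_of_one_le₀ ht.le)]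
  have h1 : ∫ t in Ioc (0:ℝ) 1, (t : ℂ) ^ (s - 1) • ((min 1 t⁻¹ : ℝ) : ℂ) = 1 / s := by
    rw [← hI.2, mellin, ← integral_indicator measurableSet_Ioi, ← integral_indicator measurableSet_Ioc]
    congr 1
    ext t
    by_cases ht : t ∈ Ioc (0:ℝ) 1
    · have h1 : t ∈ Ioi (0:ℝ) := ht.1
      have h2 : min 1 t⁻¹ = 1 := min_eq_left ((one_le_inv₀ ht.1).2 ht.2)
      simp [ht, h2, indicator_of_mem h1]
    · rw [indicator_of_notMem ht]
      simp [Set.indicator, ht, -mem_Ioc, -mem_Ici]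
  rw [h1]
  field_simp
  ring

/-- The part of the Mellin transform of `x ↦ fract x⁻¹` coming from `(0, 1]`. -/
def fractInvIoc : ℝ → ℂ := indicator (Ioc 0 1) fun x => ((Int.fract x⁻¹ : ℝ) : ℂ)

/-- Vanishing beyond `1` removes the upper restriction on `re s`, so this piece is holomorphic
across `re s = 1`. That makes continuation from the half-plane of convergence of the zeta series
possible. -/
theorem differentiableAt_mellin_fractInvIoc {s : ℂ} (hs : 0 < s.re) :
    DifferentiableAt ℂ (mellin fractInvIoc) s := by
  have hle : ∀ x, ‖fractInvIoc x‖ ≤ 1 := by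
    intro x
    rw [fractInvIoc]
    by_cases hx : x ∈ Ioc (0:ℝ) 1
    · rw [indicator_of_mem hx, Complex.norm_real, Real.norm_of_nonneg (Int.fract_nonneg _)]
      exact (Int.fract_lt_one _).le
    · simp [indicator_of_notMem hx]
  refine mellin_differentiableAt_of_isBigO_rpow (a := s.re + 1) (b := 0)
    (locallyIntegrableOn_Ioi_of_norm_le_one ?_ fun x _ => hle x) ?_ (by linarith) ?_ hs
  · exact (Complex.measurable_ofReal.comp (measurable_fract.comp measurable_inv)).indicator
      measurableSet_Ioc
  · refine IsBigO.of_bound 1 ?_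
    filter_upwards [eventually_gt_atTop 1] with x hx
    have : x ∉ Ioc (0:ℝ) 1 := fun h => absurd h.2 (not_le.2 hx)
    rw [fractInvIoc, indicator_of_notMem this]
    simp
  · refine IsBigO.of_bound 1 ?_
    filter_upwards with x
    simpa using hle x

/-- Substitute `x ↦ x⁻¹`, write the fractional part as `t - ⌊t⌋`, and use the Abel summation formula
`ζ(s) = s ∫₁^∞ ⌊t⌋ t^(-s-1) dt`. -/
theorem mellin_fractInvIoc_of_one_lt {s : ℂ} (hs : 1 < s.re) :
    mellin fractInvIoc s = 1 / (s - 1) - riemannZeta s / s := by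
  have hs0 : s ≠ 0 := by rintro rfl; simp at hs; linarith
  have hs1 : s - 1 ≠ 0 := by
    intro h; have : s = 1 := by linear_combination h
    simp [this] at hs
  have hz : riemannZeta s = s * ∫ t in Ioi (1 : ℝ), ((⌊t⌋₊ : ℝ) : ℂ) * (t : ℂ) ^ (-(s + 1)) := by
    rw [← LSeries_one_eq_riemannZeta hs]
    have := LSeries_eq_mul_integral_of_nonneg (fun _ => 1) zero_le_one hs (by
      simpa using isBigO_refl _ _) (fun _ => zero_le_one)
    simpa using! this
  have hint : IntegrableOn (fun t : ℝ => (t : ℂ) ^ (-s)) (Ioi 1) :=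
    integrableOn_Ioi_cpow_of_lt (by simpa using hs) zero_lt_one
  have hint2 : IntegrableOn (fun t : ℝ => ((⌊t⌋₊ : ℝ) : ℂ) * (t : ℂ) ^ (-(s + 1))) (Ioi 1) := by
    refine hint.norm.mono' ?_ ?_
    · refine AEStronglyMeasurable.mul ?_ ?_
      · exact (Complex.measurable_ofReal.comp
          (measurable_from_top.comp Nat.measurable_floor)).aestronglyMeasurable
      · refine (ContinuousOn.aestronglyMeasurable ?_ measurableSet_Ioi)
        intro t ht
        exact (Complex.continuousAt_ofReal_cpow_const _ _ (Or.inr (zero_lt_one.trans ht).ne')).continuousWithinAt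
    · refine (ae_restrict_iff' measurableSet_Ioi).2 (ae_of_all _ fun t (ht : 1 < t) => ?_)
      have ht0 := zero_lt_one.trans ht
      rw [norm_mul, Complex.norm_cpow_eq_rpow_re_of_pos ht0, Complex.norm_cpow_eq_rpow_re_of_pos ht0,
        Complex.norm_real, Real.norm_of_nonneg (by positivity)]
      have : t ^ (-s).re = t * t ^ (-(s+1)).re := by
        rw [← Real.rpow_one_add' ht0.le]
        · congr 1; simp
        · simp; linarith
      rw [this]
      gcongr
      exact Nat.floor_le ht0.le
  have e : fractInvIoc = fun t : ℝ => (indicator (Ici 1) (fun x => ((Int.fract x : ℝ) : ℂ))) t⁻¹ := by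
    ext t
    simp only [fractInvIoc]
    by_cases ht : t ∈ Ioc (0:ℝ) 1
    · have : t⁻¹ ∈ Ici (1:ℝ) := (one_le_inv₀ ht.1).2 ht.2
      rw [indicator_of_mem ht, indicator_of_mem this]
    · have : t⁻¹ ∉ Ici (1:ℝ) := by
        intro h
        have h' : 0 < t := inv_pos.1 (zero_lt_one.trans_le h)
        exact ht ⟨h', (one_le_inv₀ h').1 h⟩
      rw [indicator_of_notMem ht, indicator_of_notMem this]
  rw [e, mellin_comp_inv, mellin]
  have : ∫ t in Ioi (0:ℝ), (t : ℂ) ^ (-s - 1) • indicator (Ici 1) (fun x => ((Int.fract x : ℝ) : ℂ)) t =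
      ∫ t in Ioi (1:ℝ), ((t : ℂ) ^ (-s) - ((⌊t⌋₊ : ℝ) : ℂ) * (t : ℂ) ^ (-(s + 1))) := by
    rw [← integral_Ici_eq_integral_Ioi (x := 1), ← integral_indicator measurableSet_Ioi,
      ← integral_indicator measurableSet_Ici]
    congr 1
    ext t
    by_cases ht : t ∈ Ici (1:ℝ)
    · have ht0 : 0 < t := zero_lt_one.trans_le ht
      have ht0' : (t : ℂ) ≠ 0 := by exact_mod_cast ht0.ne'
      rw [indicator_of_mem (show t ∈ Ioi 0 from ht0), indicator_of_mem ht, indicator_of_mem ht,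
        show -s = 1 + (-s - 1) by ring, Complex.cpow_add _ _ ht0', Complex.cpow_one,
        show -(s+1) = 1 + (-s - 1) - 1 by ring, Complex.cpow_sub _ _ ht0',
        Complex.cpow_add _ _ ht0', Complex.cpow_one, ← Int.self_sub_floor,
        ← natCast_floor_eq_intCast_floor ht0.le]
      push_cast
      simp only [smul_eq_mul]
      field_simp
    · rw [indicator_of_notMem ht]
      simp [Set.indicator, ht, -mem_Ioc, -mem_Ici]
  rw [this, integral_sub hint hint2, integral_Ioi_cpow_of_lt (by simpa using hs) zero_lt_one, hz]
  have : -s + 1 ≠ 0 := by intro h; apply hs1; linear_combination -h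
  simp only [Complex.ofReal_one, Complex.one_cpow]
  field_simp
  ring

/-- Identity theorem on `re z > 0`, after multiplication by `z - 1` to clear the pole;
`riemannZeta₁` is the entire function extending `(z - 1) ζ(z)`. -/
theorem mellin_fractInvIoc {s : ℂ} (hs : 0 < s.re) (hs1 : s ≠ 1) :
    mellin fractInvIoc s = 1 / (s - 1) - riemannZeta s / s := by
  have hU : IsOpen {z : ℂ | 0 < z.re} := isOpen_lt continuous_const Complex.continuous_re
  have hd : ∀ z : ℂ, 0 < z.re → z ≠ 0 := by rintro z hz rfl; simp at hz
  have hf : AnalyticOnNhd ℂ (fun z => (z - 1) * mellin fractInvIoc z) {z : ℂ | 0 < z.re} := by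
    refine DifferentiableOn.analyticOnNhd (fun z hz => ?_) hU
    exact ((differentiableAt_id.sub_const _).mul
      (differentiableAt_mellin_fractInvIoc hz)).differentiableWithinAt
  have hg : AnalyticOnNhd ℂ (fun z => 1 - riemannZeta₁ z / z) {z : ℂ | 0 < z.re} := by
    refine DifferentiableOn.analyticOnNhd (fun z hz => ?_) hU
    exact ((differentiableAt_const _).sub
      (differentiable_riemannZeta₁.differentiableAt.div differentiableAt_id (hd z hz))).differentiableWithinAt
  have key := hf.eqOn_of_preconnected_of_eventuallyEq hg
    (convex_halfSpace_re_gt 0).isPreconnected (z₀ := 2) (by simp) (by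
      have : {z : ℂ | 1 < z.re} ∈ 𝓝 (2 : ℂ) :=
        (isOpen_lt continuous_const Complex.continuous_re).mem_nhds (by simp)
      filter_upwards [this] with z hz
      have hz1 : z ≠ 1 := by rintro rfl; simp at hz
      have hz1' : z - 1 ≠ 0 := sub_ne_zero.2 hz1
      have hz0 := hd z (zero_lt_one.trans hz)
      rw [mellin_fractInvIoc_of_one_lt hz, riemannZeta_eq_inv_sub_mul hz1]
      field_simp)
  have h := key hs
  have hs1' : s - 1 ≠ 0 := sub_ne_zero.2 hs1
  have := hd s hs
  simp only at h
  rw [riemannZeta_eq_inv_sub_mul hs1]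
  field_simp
  field_simp at h
  linear_combination h

theorem fract_inv_le_min (x : ℝ) (hx : 0 < x) : Int.fract x⁻¹ ≤ min 1 x⁻¹ :=
  le_min (Int.fract_lt_one _).le (by
    rw [← Int.self_sub_floor]
    have : (0 : ℤ) ≤ ⌊x⁻¹⌋ := Int.floor_nonneg.2 (inv_pos.2 hx).le
    have : (0 : ℝ) ≤ ⌊x⁻¹⌋ := by exact_mod_cast this
    linarith)

theorem mellinConvergent_fract_inv {s : ℂ} (hs0 : 0 < s.re) (hs1 : s.re < 1) :
    MellinConvergent (fun x : ℝ => ((Int.fract x⁻¹ : ℝ) : ℂ)) s :=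
  mellinConvergent_of_le_min (measurable_fract.comp measurable_inv)
    (fun _ _ => Int.fract_nonneg _) fract_inv_le_min hs0 hs1

/-- On `(1, ∞)` the kernel is `x⁻¹` and contributes `1/(1-s)`, which cancels the polar term of the
piece on `(0, 1]`. -/
theorem mellin_fract_inv {s : ℂ} (hs0 : 0 < s.re) (hs1 : s.re < 1) :
    mellin (fun x : ℝ => ((Int.fract x⁻¹ : ℝ) : ℂ)) s = - riemannZeta s / s := by
  have hc := mellinConvergent_fract_inv hs0 hs1
  have hs' : s ≠ 1 := by rintro rfl; simp at hs1
  rw [MellinConvergent] at hc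
  rw [mellin, setIntegral_Ioi_zero_eq_add hc, setIntegral_Ioi_one_cpow_mul_inv hs1]
  · have h1 : ∫ t in Ioc (0:ℝ) 1, (t : ℂ) ^ (s - 1) • ((Int.fract t⁻¹ : ℝ) : ℂ) =
        mellin fractInvIoc s := by
      rw [mellin, ← integral_indicator measurableSet_Ioi, ← integral_indicator measurableSet_Ioc]
      congr 1
      ext t
      by_cases ht : t ∈ Ioc (0:ℝ) 1
      · rw [indicator_of_mem ht, indicator_of_mem (show t ∈ Ioi 0 from ht.1), fractInvIoc,
          indicator_of_mem ht]
      · rw [indicator_of_notMem ht]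
        simp [Set.indicator, fractInvIoc, ht, -mem_Ioc]
    rw [h1, mellin_fractInvIoc hs0 hs']
    have : s - 1 ≠ 0 := sub_ne_zero.2 hs'
    have : 1 - s ≠ 0 := sub_ne_zero.2 (Ne.symm hs')
    have : s ≠ 0 := by rintro rfl; simp at hs0
    field_simp
    ring
  · intro t ht
    exact Int.fract_eq_self.2 ⟨(inv_pos.2 (zero_lt_one.trans ht)).le, inv_lt_one_of_one_lt₀ ht⟩

/-- At a real point the Mellin integrand is nonnegative, and positive for `t > 1`, so `-ζ(D)/D > 0`.
Consequently a zero on the line is not real, and the constant of the second term in the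
counterexample is nonzero. -/
theorem riemannZeta_ne_zero_of_mem_Ioo {D : ℝ} (h0 : 0 < D) (h1 : D < 1) :
    riemannZeta D ≠ 0 ∧ ∃ A : ℝ, 0 < A ∧
      mellin (fun x : ℝ => ((Int.fract x⁻¹ : ℝ) : ℂ)) D = A := by
  have hc := mellinConvergent_fract_inv (s := D) (by simpa) (by simpa)
  have e : ∀ t ∈ Ioi (0:ℝ), (t : ℂ) ^ ((D : ℂ) - 1) • ((Int.fract t⁻¹ : ℝ) : ℂ) =
      ((t ^ (D - 1) * Int.fract t⁻¹ : ℝ) : ℂ) := by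
    intro t ht
    rw [smul_eq_mul, Complex.ofReal_mul, Complex.ofReal_cpow (le_of_lt ht)]
    push_cast
    rfl
  have hr : IntegrableOn (fun t : ℝ => t ^ (D - 1) * Int.fract t⁻¹) (Ioi 0) := by
    have := (hc.congr_fun e measurableSet_Ioi).re
    rw [IntegrableOn]
    simpa using this
  have hm : mellin (fun x : ℝ => ((Int.fract x⁻¹ : ℝ) : ℂ)) D =
      ((∫ t in Ioi (0:ℝ), t ^ (D - 1) * Int.fract t⁻¹ : ℝ) : ℂ) := by
    rw [mellin, setIntegral_congr_fun measurableSet_Ioi e, integral_complex_ofReal]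
  have hpos : 0 < ∫ t in Ioi (0:ℝ), t ^ (D - 1) * Int.fract t⁻¹ := by
    rw [setIntegral_pos_iff_support_of_nonneg_ae ?_ hr]
    · refine lt_of_lt_of_le ?_ (measure_mono (s := Ioi (1:ℝ)) fun t ht => ⟨?_, ?_⟩)
      · simp
      · have ht0 : (0:ℝ) < t := zero_lt_one.trans ht
        have : Int.fract t⁻¹ = t⁻¹ :=
          Int.fract_eq_self.2 ⟨(inv_pos.2 ht0).le, inv_lt_one_of_one_lt₀ ht⟩
        simp only [Function.mem_support, this]
        positivity
      · exact zero_lt_one.trans (show 1 < t from ht)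
    · refine (ae_restrict_iff' measurableSet_Ioi).2 (ae_of_all _ fun t (ht : 0 < t) => ?_)
      exact mul_nonneg (Real.rpow_nonneg ht.le _) (Int.fract_nonneg _)
  refine ⟨fun hz => ?_, _, hpos, hm⟩
  rw [mellin_fract_inv (by simpa) (by simpa), hz] at hm
  simp only [neg_zero, zero_div] at hm
  exact hpos.ne (by exact_mod_cast hm)

/-! ### Tube volume and spectral counting function as sums over the lengths. -/

namespace FractalString

variable (L : FractalString)

theorem length_pos (j : ℕ) : 0 < L.length j := sub_pos.2 (L.left_lt_right j)

theorem isOpen_domain : IsOpen L.domain := isOpen_iUnion fun _ => isOpen_Ioo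

theorem volume_domain_eq_tsum : volume L.domain = ∑' j, ENNReal.ofReal (L.length j) := by
  rw [domain, measure_iUnion (fun i j h => L.disjoint i j h) fun _ => measurableSet_Ioo]
  simp [length]

theorem summable_length : Summable L.length := by
  have h : volume L.domain ≠ ⊤ := L.bounded.measure_lt_top.ne
  rw [volume_domain_eq_tsum] at h
  have := ENNReal.summable_toReal h
  simpa [ENNReal.toReal_ofReal (L.length_pos _).le] using this

theorem volume_domain : volume L.domain = ENNReal.ofReal (∑' j, L.length j) := by
  rw [volume_domain_eq_tsum, ENNReal.ofReal_tsum_of_nonneg (fun j => (L.length_pos j).le)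
    L.summable_length]

/-- The sum `∑ⱼ min(1, x ℓⱼ)`, a rescaling of the volume of the inner tube. -/
def truncSum (x : ℝ) : ℝ := ∑' j, min 1 (x * L.length j)

/-- The sum of the fractional parts of `x ℓⱼ`. -/
def fractSum (x : ℝ) : ℝ := ∑' j, Int.fract (x * L.length j)

theorem summable_min_one {x : ℝ} (hx : 0 ≤ x) : Summable fun j => min 1 (x * L.length j) :=
  (L.summable_length.mul_left x).of_nonneg_of_le
    (fun j => le_min zero_le_one (mul_nonneg hx (L.length_pos j).le)) fun _ => min_le_right _ _

theorem fract_le_min {y : ℝ} (hy : 0 ≤ y) : Int.fract y ≤ min 1 y := by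
  refine le_min (Int.fract_lt_one _).le ?_
  rw [← Int.self_sub_floor]
  have : (0 : ℝ) ≤ ⌊y⌋ := by exact_mod_cast Int.floor_nonneg.2 hy
  linarith

theorem summable_fract {x : ℝ} (hx : 0 ≤ x) : Summable fun j => Int.fract (x * L.length j) :=
  (L.summable_min_one hx).of_nonneg_of_le (fun _ => Int.fract_nonneg _)
    fun j => fract_le_min (mul_nonneg hx (L.length_pos j).le)

theorem right_notMem_domain (j : ℕ) : L.right j ∉ L.domain := by
  intro h
  obtain ⟨k, hk⟩ := mem_iUnion.1 h
  have hjk : j ≠ k := by rintro rfl; exact lt_irrefl _ hk.2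
  have h1 : max (L.left j) (L.left k) < L.right j := max_lt (L.left_lt_right j) hk.1
  obtain ⟨z, hz1, hz2⟩ := exists_between h1
  exact Set.disjoint_left.1 (L.disjoint j k hjk) ⟨(le_max_left _ _).trans_lt hz1, hz2⟩
    ⟨(le_max_right _ _).trans_lt hz1, hz2.trans hk.2⟩

theorem left_notMem_domain (j : ℕ) : L.left j ∉ L.domain := by
  intro h
  obtain ⟨k, hk⟩ := mem_iUnion.1 h
  have hjk : j ≠ k := by rintro rfl; exact lt_irrefl _ hk.1
  have h1 : L.left j < min (L.right j) (L.right k) := lt_min (L.left_lt_right j) hk.2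
  obtain ⟨z, hz1, hz2⟩ := exists_between h1
  exact Set.disjoint_left.1 (L.disjoint j k hjk) ⟨hz1, hz2.trans_le (min_le_left _ _)⟩
    ⟨hk.1.trans hz1, hz2.trans_le (min_le_right _ _)⟩

theorem right_mem_frontier (j : ℕ) : L.right j ∈ frontier L.domain := by
  rw [L.isOpen_domain.frontier_eq]
  refine ⟨closure_mono (subset_iUnion _ j) ?_, L.right_notMem_domain j⟩
  rw [closure_Ioo (L.left_lt_right j).ne]
  exact right_mem_Icc.2 (L.left_lt_right j).le

theorem left_mem_frontier (j : ℕ) : L.left j ∈ frontier L.domain := by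
  rw [L.isOpen_domain.frontier_eq]
  refine ⟨closure_mono (subset_iUnion _ j) ?_, L.left_notMem_domain j⟩
  rw [closure_Ioo (L.left_lt_right j).ne]
  exact left_mem_Icc.2 (L.left_lt_right j).le

/-- No frontier point lies inside a component, so the two endpoints of the component are the nearest
ones. -/
theorem infDist_frontier_lt_iff {j : ℕ} {x ε : ℝ} (hx : x ∈ Ioo (L.left j) (L.right j)) :
    Metric.infDist x (frontier L.domain) < ε ↔ x - L.left j < ε ∨ L.right j - x < ε := by
  rw [Metric.infDist_lt_iff ⟨_, L.right_mem_frontier j⟩]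
  constructor
  · rintro ⟨y, hy, hxy⟩
    rw [L.isOpen_domain.frontier_eq] at hy
    have hy' : y ∉ Ioo (L.left j) (L.right j) := fun h => hy.2 (mem_iUnion.2 ⟨j, h⟩)
    rw [Real.dist_eq, abs_lt] at hxy
    by_cases h : L.left j < y
    · right
      have : L.right j ≤ y := not_lt.1 fun h' => hy' ⟨h, h'⟩
      linarith
    · left
      linarith
  · rintro (h | h)
    · exact ⟨_, L.left_mem_frontier j, by rwa [Real.dist_eq, abs_of_pos (sub_pos.2 hx.1)]⟩
    · refine ⟨_, L.right_mem_frontier j, ?_⟩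
      rwa [dist_comm, Real.dist_eq, abs_of_pos (sub_pos.2 hx.2)]

/-- The part of the inner tube inside the `j`-th interval. -/
def tubePiece (ε : ℝ) (j : ℕ) : Set ℝ :=
  Ioo (L.left j) (min (L.left j + ε) (L.right j)) ∪
    Ioo (max (L.right j - ε) (L.left j)) (L.right j)

theorem innerTube_eq_iUnion (ε : ℝ) : L.innerTube ε = ⋃ j, L.tubePiece ε j := by
  ext x
  simp only [innerTube, domain, mem_ofPred_eq, mem_iUnion]
  constructor
  · rintro ⟨⟨j, hj⟩, h⟩
    refine ⟨j, ?_⟩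
    rcases (L.infDist_frontier_lt_iff hj).1 h with h | h
    · exact Or.inl ⟨hj.1, lt_min (by linarith) hj.2⟩
    · exact Or.inr ⟨max_lt (by linarith) hj.1, hj.2⟩
  · rintro ⟨j, h | h⟩
    · have hj : x ∈ Ioo (L.left j) (L.right j) := ⟨h.1, h.2.trans_le (min_le_right _ _)⟩
      have := h.2.trans_le (min_le_left _ _)
      exact ⟨⟨j, hj⟩, (L.infDist_frontier_lt_iff hj).2 (Or.inl (by linarith))⟩
    · have hj : x ∈ Ioo (L.left j) (L.right j) := ⟨(le_max_right _ _).trans_lt h.1, h.2⟩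
      have := (le_max_left _ _).trans_lt h.1
      exact ⟨⟨j, hj⟩, (L.infDist_frontier_lt_iff hj).2 (Or.inr (by linarith))⟩

theorem tubePiece_subset (ε : ℝ) (j : ℕ) : L.tubePiece ε j ⊆ Ioo (L.left j) (L.right j) :=
  union_subset (Ioo_subset_Ioo_right (min_le_right _ _)) (Ioo_subset_Ioo_left (le_max_right _ _))

theorem volume_tubePiece {ε : ℝ} (hε : 0 < ε) (j : ℕ) :
    volume (L.tubePiece ε j) = ENNReal.ofReal (min (2 * ε) (L.length j)) := by
  have hlr := L.left_lt_right j
  rcases le_or_gt (2 * ε) (L.length j) with h | h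
  · rw [min_eq_left h]
    rw [length] at h
    rw [tubePiece, min_eq_left (by linarith), max_eq_left (by linarith),
      measure_union _ measurableSet_Ioo, Real.volume_Ioo, Real.volume_Ioo,
      ← ENNReal.ofReal_add (by linarith) (by linarith)]
    · congr 1; ring
    · exact Set.disjoint_left.2 fun x hx hx' => by linarith [hx.2, hx'.1]
  · rw [min_eq_right h.le]
    have : L.tubePiece ε j = Ioo (L.left j) (L.right j) := by
      refine (L.tubePiece_subset ε j).antisymm fun x hx => ?_
      rw [length] at h
      by_cases hx' : x < L.left j + ε
      · exact Or.inl ⟨hx.1, lt_min hx' hx.2⟩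
      · exact Or.inr ⟨max_lt (by linarith) hx.1, hx.2⟩
    rw [this, Real.volume_Ioo, length]

theorem volume_innerTube {ε : ℝ} (hε : 0 < ε) :
    volume (L.innerTube ε) = ENNReal.ofReal (2 * ε * L.truncSum (2 * ε)⁻¹) := by
  have e : ∀ j, min (2 * ε) (L.length j) = 2 * ε * min 1 ((2 * ε)⁻¹ * L.length j) := by
    intro j
    rw [mul_min_of_nonneg _ _ (by positivity)]
    congr 1
    · ring
    · field_simp
  rw [innerTube_eq_iUnion, measure_iUnion]
  · simp_rw [L.volume_tubePiece hε, e]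
    rw [truncSum, ← tsum_mul_left, ENNReal.ofReal_tsum_of_nonneg]
    · intro j
      have := L.length_pos j
      positivity
    · exact (L.summable_min_one (by positivity)).mul_left _
  · exact fun i j h => (L.disjoint i j h).mono (L.tubePiece_subset ε i) (L.tubePiece_subset ε j)
  · exact fun j => measurableSet_Ioo.union measurableSet_Ioo

/-- The content ratio in terms of `x = (2ε)⁻¹`. -/
theorem contentRatio_eq (d : ℝ) {ε : ℝ} (hε : 0 < ε) :
    L.contentRatio d ε =
      ENNReal.ofReal (2 ^ (1 - d) * (((2 * ε)⁻¹) ^ (-d) * L.truncSum (2 * ε)⁻¹)) := by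
  rw [contentRatio, L.volume_innerTube hε, ← ENNReal.ofReal_div_of_pos (by positivity)]
  congr 1
  rw [Real.inv_rpow (by positivity), Real.rpow_neg (by positivity), inv_inv,
    Real.mul_rpow (by norm_num) hε.le, Real.rpow_sub hε,
    Real.rpow_sub (by norm_num : (0:ℝ) < 2), Real.rpow_one, Real.rpow_one]
  have := Real.rpow_pos_of_pos hε d
  field_simp

theorem finite_one_le_mul_length (x : ℝ) :
    {j | 1 ≤ x * L.length j}.Finite := by
  have h := (L.summable_length.mul_left x).tendsto_cofinite_zero
  have := h.eventually (gt_mem_nhds zero_lt_one)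
  rw [eventually_cofinite] at this
  simpa using this

theorem spectralCount_eq_tsum {x : ℝ} (hx : 0 ≤ x) :
    (L.spectralCount x : ℝ) = ∑' j, (⌊x * L.length j⌋₊ : ℝ) := by
  classical
  set s := (L.finite_one_le_mul_length x).toFinset with hs
  -- An explicit finset is needed because `ncard` is `0` on infinite sets. Only the finitely many
  -- `j` with `xℓⱼ ≥ 1` contribute, each with `⌊xℓⱼ⌋` values of `n`.
  have hset : {p : ℕ × ℕ | 1 ≤ p.1 ∧ (p.1 : ℝ) * (L.length p.2)⁻¹ ≤ x} =
      ((s.sigma fun j => Finset.Icc 1 ⌊x * L.length j⌋₊).map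
        ⟨fun p : (_ : ℕ) × ℕ => ((p.2, p.1) : ℕ × ℕ), fun p q h => by
          cases p; cases q; simp at h; simp [h]⟩ : Finset (ℕ × ℕ)) := by
    ext ⟨n, j⟩
    have hj := L.length_pos j
    have h1 : (n : ℝ) * (L.length j)⁻¹ ≤ x ↔ n ≤ ⌊x * L.length j⌋₊ := by
      rw [Nat.le_floor_iff (by positivity), ← div_eq_mul_inv, div_le_iff₀ hj]
    simp only [mem_ofPred_eq, h1, Finset.coe_map, mem_image,
      Finset.mem_coe, Finset.mem_sigma, Finset.mem_Icc, hs, Finite.mem_toFinset]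
    constructor
    · rintro ⟨h, h'⟩
      refine ⟨⟨j, n⟩, ⟨?_, h, h'⟩, rfl⟩
      exact Nat.one_le_floor_iff _ |>.1 (h.trans h')
    · rintro ⟨⟨j', n'⟩, ⟨_, h, h'⟩, he⟩
      have he' : (n', j') = (n, j) := he
      obtain ⟨rfl, rfl⟩ : n' = n ∧ j' = j := by simpa using he'
      exact ⟨h, h'⟩
  rw [spectralCount, hset, ncard_coe_finset, Finset.card_map, Finset.card_sigma,
    tsum_eq_sum (s := s)]
  · simp
  · intro j hj
    have : ¬ 1 ≤ x * L.length j := by simpa [hs] using hj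
    simpa [Nat.floor_eq_zero] using this

theorem weylTerm_sub_spectralCount {x : ℝ} (hx : 0 ≤ x) :
    L.weylTerm x - L.spectralCount x = L.fractSum x := by
  have h0 : ∀ j, 0 ≤ x * L.length j := fun j => mul_nonneg hx (L.length_pos j).le
  have e : ∀ j, (⌊x * L.length j⌋₊ : ℝ) = x * L.length j - Int.fract (x * L.length j) := by
    intro j
    rw [Int.self_sub_fract, natCast_floor_eq_intCast_floor (h0 j)]
  rw [L.spectralCount_eq_tsum hx, tsum_congr e, (L.summable_length.mul_left x).tsum_sub
    (L.summable_fract hx), weylTerm, volume_domain, ENNReal.toReal_ofReal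
    (tsum_nonneg fun j => (L.length_pos j).le), fractSum, tsum_mul_left]
  ring

/-- The spectral hypothesis, expressed through the sum of fractional parts. -/
theorem hasMonotonicSecondTerm_iff (D : ℝ) :
    L.HasMonotonicSecondTerm D ↔
      ∃ C : ℝ, C ≠ 0 ∧ Tendsto (fun x : ℝ => x ^ (-D) * L.fractSum x) atTop (𝓝 C) := by
  refine exists_congr fun C => and_congr_right fun _ => ?_
  rw [isLittleO_iff_tendsto' (by
    filter_upwards [eventually_gt_atTop 0] with x hx h
    exact absurd h (Real.rpow_pos_of_pos hx D).ne')]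
  have e : (fun x : ℝ => ((L.spectralCount x : ℝ) - (L.weylTerm x - C * x ^ D)) / x ^ D) =ᶠ[atTop]
      fun x => C - x ^ (-D) * L.fractSum x := by
    filter_upwards [eventually_gt_atTop 0] with x hx
    rw [← L.weylTerm_sub_spectralCount hx.le, Real.rpow_neg hx.le]
    have := Real.rpow_pos_of_pos hx D
    field_simp
    ring
  rw [tendsto_congr' e]
  constructor
  · intro h
    simpa using h.const_sub C
  · intro h
    simpa using h.const_sub C

end FractalString

/-! ### A Wiener type Tauberian theorem for smooth quotients. -/

/-- A smooth compactly supported function on `ℝ` with value `1` at `0`, dilated by `r`. -/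
def dilatedBump (r : ℝ) (ξ : ℝ) : ℂ := ((default : ContDiffBump (0 : ℝ)) (ξ / r) : ℝ)

theorem contDiff_dilatedBump (r : ℝ) : ContDiff ℝ ∞ (dilatedBump r) :=
  Complex.ofRealCLM.contDiff.comp
    ((default : ContDiffBump (0 : ℝ)).contDiff.comp (contDiff_id.div_const r))

theorem hasCompactSupport_dilatedBump {r : ℝ} (hr : 0 < r) : HasCompactSupport (dilatedBump r) := by
  have h : HasCompactSupport fun x : ℝ => (((default : ContDiffBump (0 : ℝ)) x : ℝ) : ℂ) :=
    (default : ContDiffBump (0 : ℝ)).hasCompactSupport.comp_left (g := Complex.ofReal) rfl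
  exact h.comp_homeomorph ((Homeomorph.mulRight₀ r hr.ne').symm)

theorem fourier_dilatedBump {r : ℝ} (hr : 0 < r) (u : ℝ) :
    𝓕 (dilatedBump r) u = r * 𝓕 (dilatedBump 1) (r * u) := by
  rw [Real.fourier_real_eq_integral_exp_smul, Real.fourier_real_eq_integral_exp_smul]
  have := Measure.integral_comp_div
    (fun v : ℝ => Complex.exp (↑(-2 * Real.pi * v * (r * u)) * Complex.I) • dilatedBump 1 v) r
  rw [abs_of_pos hr] at this
  rw [← Complex.real_smul, ← this]
  congr 1
  ext v
  congr 1
  · have : -2 * Real.pi * v * u = -2 * Real.pi * (v / r) * (r * u) := by field_simp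
    rw [this]
  · simp [dilatedBump]

/-- A bounded uniformly Lipschitz function converges at infinity as soon as all its averages against
Fourier transforms of test functions do. -/
theorem exists_tendsto_of_tendsto_integral_fourier {F : ℝ → ℝ} {B M : ℝ}
    (hB : ∀ t u, |F t - F (t - u)| ≤ B * |u|) (hM : ∀ t, |F t| ≤ M)
    (h : ∀ φ : 𝓢(ℝ, ℂ), HasCompactSupport φ →
      ∃ l : ℂ, Tendsto (fun t => ∫ u, (F (t - u) : ℂ) * 𝓕 (φ : ℝ → ℂ) u) atTop (𝓝 l)) :
    ∃ c : ℝ, Tendsto F atTop (𝓝 c) := by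
  have hFc : Continuous F := by
    have hB0 : 0 ≤ B := by simpa using (abs_nonneg _).trans (hB 0 1)
    refine (LipschitzWith.of_dist_le_mul (K := ⟨B, hB0⟩) fun x y => ?_).continuous
    have := hB x (x - y)
    rwa [sub_sub_cancel] at this
  let φ : 𝓢(ℝ, ℂ) := (hasCompactSupport_dilatedBump one_pos).toSchwartzMap
    (contDiff_dilatedBump 1)
  have hφ : (φ : ℝ → ℂ) = dilatedBump 1 := rfl
  set g : 𝓢(ℝ, ℂ) := 𝓕 φ with hg
  have hgc : (g : ℝ → ℂ) = 𝓕 (dilatedBump 1) := rfl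
  -- By Fourier inversion at `0` the integral is `φ 0 = 1`, so the transforms of the dilated bumps
  -- form an approximate identity as `r → ∞`.
  have hg1 : ∫ u, g u = 1 := by
    have h1 : 𝓕⁻ (g : ℝ → ℂ) 0 = φ 0 := by
      rw [hg, ← SchwartzMap.fourierInv_coe, FourierTransform.fourierInv_fourier_eq]
    rw [Real.fourierInv_eq'] at h1
    have h2 : φ 0 = 1 := by
      rw [hφ, dilatedBump, zero_div, ContDiffBump.one_of_mem_closedBall _
        (Metric.mem_closedBall_self (default : ContDiffBump (0 : ℝ)).rIn_pos.le), Complex.ofReal_one]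
    simpa [h2] using h1
  have hgi : Integrable (fun u => |u| * ‖g u‖) := by
    simpa using g.integrable_pow_mul volume 1
  set A := ∫ u, |u| * ‖g u‖ with hA
  -- the averaged functions are uniformly close to `F`
  have hclose : ∀ r : ℝ, 0 < r → ∀ t,
      ‖(F t : ℂ) - ∫ u, (F (t - u) : ℂ) * 𝓕 (dilatedBump r) u‖ ≤ B / r * A := by
    intro r hr t
    have e1 : ∫ u, (F (t - u) : ℂ) * 𝓕 (dilatedBump r) u = ∫ v, (F (t - v / r) : ℂ) * g v := by
      have := Measure.integral_comp_mul_left (fun v => (F (t - v / r) : ℂ) * g v) r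
      rw [abs_of_pos (inv_pos.2 hr)] at this
      have h2 : ∫ v, (F (t - v / r) : ℂ) * g v =
          r • ∫ (x : ℝ), (F (t - r * x / r) : ℂ) * g (r * x) := by
        rw [this, smul_smul, mul_inv_cancel₀ hr.ne', one_smul]
      rw [h2, ← integral_smul]
      congr 1
      ext u
      rw [fourier_dilatedBump hr, mul_div_cancel_left₀ _ hr.ne', hgc, Complex.real_smul]
      ring
    have hint : Integrable (fun v => (F (t - v / r) : ℂ) * g v) := by
      refine g.integrable.bdd_mul (c := M) ?_ ?_
      · exact (Complex.continuous_ofReal.comp (hFc.comp (by fun_prop))).aestronglyMeasurable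
      · exact ae_of_all _ fun v => by simpa using hM _
    have e2 : (F t : ℂ) = ∫ v, (F t : ℂ) * g v := by
      rw [integral_const_mul, hg1, mul_one]
    rw [e1, e2, ← integral_sub (g.integrable.const_mul _) hint, hA, ← integral_const_mul]
    refine norm_integral_le_of_norm_le (hgi.const_mul _) (ae_of_all _ fun v => ?_)
    rw [← sub_mul, norm_mul, ← Complex.ofReal_sub, Complex.norm_real, ← mul_assoc]
    gcongr
    refine (hB t (v / r)).trans (le_of_eq ?_)
    rw [abs_div, abs_of_pos hr]
    ring
  -- Fix one dilation whose average is uniformly `ε / 4`-close to `F`. Since that average converges,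
  -- the values of `F` are eventually within `ε` of each other.
  refine cauchySeq_tendsto_of_complete (Metric.cauchySeq_iff.2 fun ε hε => ?_)
  obtain ⟨r, hr, hrε⟩ : ∃ r : ℝ, 0 < r ∧ B / r * A < ε / 4 := by
    have : Tendsto (fun r : ℝ => B / r * A) atTop (𝓝 0) := by
      simpa using (tendsto_const_nhds.div_atTop tendsto_id).mul_const A
    obtain ⟨r, h1, h2⟩ := ((this.eventually (gt_mem_nhds (show 0 < ε / 4 by positivity))).and
      (eventually_gt_atTop 0)).exists
    exact ⟨r, h2, h1⟩
  obtain ⟨l, hl⟩ := h ((hasCompactSupport_dilatedBump hr).toSchwartzMap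
    (contDiff_dilatedBump r)) (hasCompactSupport_dilatedBump hr)
  obtain ⟨N, hN⟩ := eventually_atTop.1 (hl.eventually (Metric.ball_mem_nhds l
    (show 0 < ε / 4 by positivity)))
  have hF : ∀ t ≥ N, dist (F t : ℂ) l < ε / 2 := by
    intro t ht
    have h1 : dist (∫ u, (F (t - u) : ℂ) * 𝓕 (dilatedBump r) u) l < ε / 4 := hN t ht
    have h2 := hclose r hr t
    rw [← dist_eq_norm] at h2
    calc _ ≤ _ := dist_triangle _ _ _
      _ < ε / 4 + ε / 4 := add_lt_add (h2.trans_lt hrε) h1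
      _ = ε / 2 := by ring
  refine ⟨N, fun m hm n hn => ?_⟩
  have := (dist_triangle_right (F m : ℂ) (F n) l).trans_lt (add_lt_add (hF m hm) (hF n hn))
  rw [add_halves] at this
  simpa [Complex.dist_eq, Real.dist_eq, ← Complex.ofReal_sub] using this

/-- Convolution with a Fourier transform, on the frequency side. -/
theorem integral_comp_sub_mul_fourier {k φ : ℝ → ℂ} (hk : Integrable k) (hφ : Integrable φ)
    (t : ℝ) :
    ∫ u, k (t - u) * 𝓕 φ u =
      ∫ ξ, φ ξ * (Complex.exp (((-2 * Real.pi * t * ξ : ℝ) : ℂ) * Complex.I) * 𝓕 k (-ξ)) := by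
  -- The multiplication formula `∫ 𝓕f · g = ∫ f · 𝓕g`, applied to `φ` and the reflected translate of
  -- `k`.
  have h := VectorFourier.integral_fourierIntegral_smul_eq_flip (L := innerₗ ℝ)
    (μ := volume) (ν := volume) Real.continuous_fourierChar continuous_inner hφ
    (hk.comp_sub_left t)
  have h' : ∫ u, 𝓕 φ u * k (t - u) = ∫ ξ, φ ξ * 𝓕 (fun v => k (t - v)) ξ := by
    simpa using! h
  simp_rw [mul_comm (k _)]
  rw [h']
  congr 1
  ext ξ
  congr 1
  rw [Real.fourier_real_eq_integral_exp_smul, Real.fourier_real_eq_integral_exp_smul,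
    ← integral_const_mul, ← integral_sub_left_eq_self _ _ t]
  congr 1
  ext w
  simp only [sub_sub_cancel, smul_eq_mul]
  rw [← mul_assoc, ← Complex.exp_add]
  congr 2
  push_cast
  ring

/-- The shifts of a kernel summed with weights may be integrated termwise. -/
theorem integral_tsum_shift {k : ℝ → ℝ} (hk : Measurable k) (hk0 : ∀ t, 0 ≤ k t)
    {w b : ℕ → ℝ} (hw : ∀ j, 0 ≤ w j) {M : ℝ} (hs : ∀ t, Summable fun j => w j * k (t - b j))
    (hM : ∀ t, ∑' j, w j * k (t - b j) ≤ M) {g : ℝ → ℂ} (hg : Integrable g) (t : ℝ) :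
    ∫ u, ((∑' j, w j * k (t - u - b j) : ℝ) : ℂ) * g u =
      ∑' j, (w j : ℂ) * ∫ u, (k (t - b j - u) : ℂ) * g u := by
  have e : ∀ u, ((∑' j, w j * k (t - u - b j) : ℝ) : ℂ) * g u =
      ∑' j, ((w j * k (t - u - b j) : ℝ) : ℂ) * g u := by
    intro u
    rw [Complex.ofReal_tsum, tsum_mul_right]
  have hmeas : ∀ j, AEStronglyMeasurable
      (fun u => ((w j * k (t - u - b j) : ℝ) : ℂ) * g u) volume := by
    intro j
    refine AEStronglyMeasurable.mul (Measurable.aestronglyMeasurable ?_) hg.aestronglyMeasurable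
    fun_prop
  simp_rw [e]
  rw [integral_tsum hmeas]
  · refine tsum_congr fun j => ?_
    rw [← integral_const_mul]
    congr 1
    ext u
    rw [sub_right_comm]
    push_cast
    ring
  · rw [← lintegral_tsum fun j => (hmeas j).enorm]
    refine ne_top_of_le_ne_top (b := ∫⁻ u, ENNReal.ofReal M * ‖g u‖ₑ) ?_
      (lintegral_mono fun u => ?_)
    · rw [lintegral_const_mul' _ _ ENNReal.ofReal_ne_top]
      exact ENNReal.mul_ne_top ENNReal.ofReal_ne_top hg.2.ne
    · simp_rw [enorm_mul]
      rw [ENNReal.tsum_mul_right]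
      gcongr
      have : ∀ j, ‖((w j * k (t - u - b j) : ℝ) : ℂ)‖ₑ = ENNReal.ofReal (w j * k (t - u - b j)) := by
        intro j
        rw [← ofReal_norm, Complex.norm_real, Real.norm_of_nonneg (mul_nonneg (hw j) (hk0 _))]
      simp_rw [this]
      rw [← ENNReal.ofReal_tsum_of_nonneg (fun j => mul_nonneg (hw j) (hk0 _)) (hs _)]
      exact ENNReal.ofReal_le_ofReal (hM _)

/-- A Wiener type Tauberian theorem, for kernels `k` and `m` whose Fourier transforms have a smooth
quotient, and a sum of weighted point masses. -/
theorem exists_tendsto_tsum_shift {k m : ℝ → ℝ} (hk : Measurable k) (hk0 : ∀ t, 0 ≤ k t)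
    (hki : Integrable k) (hm : Measurable m) (hm0 : ∀ t, 0 ≤ m t) (hmi : Integrable m)
    {ρ : ℝ → ℂ} (hρ : ContDiff ℝ ∞ ρ)
    (hmk : ∀ ξ, 𝓕 (fun t => (m t : ℂ)) ξ = ρ ξ * 𝓕 (fun t => (k t : ℂ)) ξ)
    {w b : ℕ → ℝ} (hw : ∀ j, 0 ≤ w j) {M B C : ℝ}
    (hks : ∀ t, Summable fun j => w j * k (t - b j)) (hkM : ∀ t, ∑' j, w j * k (t - b j) ≤ M)
    (hms : ∀ t, Summable fun j => w j * m (t - b j)) (hmM : ∀ t, ∑' j, w j * m (t - b j) ≤ M)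
    (hB : ∀ t u, |(∑' j, w j * m (t - b j)) - ∑' j, w j * m (t - u - b j)| ≤ B * |u|)
    (hC : Tendsto (fun t => ∑' j, w j * k (t - b j)) atTop (𝓝 C)) :
    ∃ c : ℝ, Tendsto (fun t => ∑' j, w j * m (t - b j)) atTop (𝓝 c) := by
  refine exists_tendsto_of_tendsto_integral_fourier hB (M := M) (fun t => ?_) fun φ hφ => ?_
  · rw [abs_of_nonneg (tsum_nonneg fun j => mul_nonneg (hw j) (hm0 _))]
    exact hmM t
  -- The factor `ρ` is moved from the kernel to the test function, which stays smooth and compactly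
  -- supported whatever the growth of `ρ`. The sign comes from `𝓕 k` being evaluated at `-ξ` in
  -- `integral_comp_sub_mul_fourier`.
  have hψc : HasCompactSupport fun ξ => φ ξ * ρ (-ξ) := hφ.mul_right
  have hψd : ContDiff ℝ ∞ fun ξ => φ ξ * ρ (-ξ) :=
    (φ.smooth ⊤).mul (hρ.comp contDiff_neg)
  let ψ : 𝓢(ℝ, ℂ) := hψc.toSchwartzMap hψd
  have hψ : ∀ ξ, ψ ξ = φ ξ * ρ (-ξ) := fun _ => rfl
  have hh : Integrable (𝓕 (ψ : ℝ → ℂ)) := (𝓕 ψ).integrable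
  have hconv : ∀ t, ∫ u, ((∑' j, w j * m (t - u - b j) : ℝ) : ℂ) * 𝓕 (φ : ℝ → ℂ) u =
      ∫ u, ((∑' j, w j * k (t - u - b j) : ℝ) : ℂ) * 𝓕 (ψ : ℝ → ℂ) u := by
    intro t
    rw [integral_tsum_shift hm hm0 hw hms hmM (𝓕 φ).integrable,
      integral_tsum_shift hk hk0 hw hks hkM hh]
    refine tsum_congr fun j => ?_
    have h1 := integral_comp_sub_mul_fourier hmi.ofReal φ.integrable (t - b j)
    have h2 := integral_comp_sub_mul_fourier hki.ofReal ψ.integrable (t - b j)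
    simp only [RCLike.ofReal_eq_complex_ofReal] at h1 h2
    rw [h1, h2]
    congr 2
    ext ξ
    rw [hmk, hψ]
    ring
  refine ⟨∫ u, (C : ℂ) * 𝓕 (ψ : ℝ → ℂ) u, ?_⟩
  simp_rw [hconv]
  have hKm : Measurable fun t => ∑' j, w j * k (t - b j) := by
    refine measurable_of_tendsto_metrizable (f := fun n t => ∑ j ∈ Finset.range n, w j * k (t - b j))
      (fun n => by fun_prop) ?_
    rw [tendsto_pi_nhds]
    exact fun t => (hks t).hasSum.tendsto_sum_nat
  refine tendsto_integral_filter_of_dominated_convergence (fun u => M * ‖𝓕 (ψ : ℝ → ℂ) u‖) ?_ ?_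
    (hh.norm.const_mul M) ?_
  · refine Eventually.of_forall fun t => AEStronglyMeasurable.mul ?_ hh.aestronglyMeasurable
    exact (Complex.measurable_ofReal.comp (hKm.comp (by fun_prop : Measurable fun u => t - u))).aestronglyMeasurable
  · refine Eventually.of_forall fun t => ae_of_all _ fun u => ?_
    rw [norm_mul, Complex.norm_real, Real.norm_of_nonneg
      (tsum_nonneg fun j => mul_nonneg (hw j) (hk0 _))]
    exact mul_le_mul_of_nonneg_right (hkM _) (norm_nonneg _)
  · refine ae_of_all _ fun u => Tendsto.mul_const _ ?_
    exact (Complex.continuous_ofReal.tendsto _).comp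
      (hC.comp (tendsto_atTop_add_const_right _ (-u) tendsto_id))

/-! ### The kernels in logarithmic scale. -/

/-- The Mellin transform of `x ↦ q x⁻¹` on the line `re s = D`, as a Fourier transform. -/
theorem fourier_exp_mul_comp_exp (q : ℝ → ℝ) (D ξ : ℝ) :
    𝓕 (fun t : ℝ => ((Real.exp (-D * t) * q (Real.exp t) : ℝ) : ℂ)) ξ =
      mellin (fun x : ℝ => (q x⁻¹ : ℂ)) (D + 2 * Real.pi * ξ * Complex.I) := by
  rw [mellin_eq_fourier]
  have h1 : ((D : ℂ) + 2 * Real.pi * ξ * Complex.I).re = D := by simp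
  have h2 : ((D : ℂ) + 2 * Real.pi * ξ * Complex.I).im / (2 * Real.pi) = ξ := by
    simp
  rw [h1, h2]
  refine congrFun (congrArg _ (funext fun t => ?_)) ξ
  rw [Real.exp_neg t, inv_inv, Complex.real_smul]
  push_cast
  rfl

/-- The bound `q y ≤ y` gives decay `e^((1-D)t)` at `-∞`, and `q y ≤ 1` gives decay `e^(-Dt)` at
`+∞`. -/
theorem integrable_exp_mul_comp_exp {q : ℝ → ℝ} (hq : Measurable q) {D : ℝ} (hD0 : 0 < D)
    (hD1 : D < 1) (h0 : ∀ y, 0 < y → 0 ≤ q y) (h1 : ∀ y, 0 < y → q y ≤ min 1 y) :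
    Integrable fun t : ℝ => Real.exp (-D * t) * q (Real.exp t) := by
  have hm : Measurable fun t : ℝ => Real.exp (-D * t) * q (Real.exp t) := by fun_prop
  have hn : ∀ t : ℝ, ‖Real.exp (-D * t) * q (Real.exp t)‖ = Real.exp (-D * t) * q (Real.exp t) :=
    fun t => Real.norm_of_nonneg (mul_nonneg (Real.exp_pos _).le (h0 _ (Real.exp_pos _)))
  rw [← integrableOn_univ, ← Iic_union_Ioi (a := (0 : ℝ)), integrableOn_union]
  constructor
  · have h : IntegrableOn (fun t : ℝ => Real.exp ((1 - D) * t)) (Iic 0) :=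
      integrableOn_exp_mul_Iic (sub_pos.2 hD1) 0
    refine h.mono' hm.aestronglyMeasurable (ae_of_all _ fun t => ?_)
    rw [hn, show (1 - D) * t = -D * t + t by ring, Real.exp_add]
    exact mul_le_mul_of_nonneg_left ((h1 _ (Real.exp_pos _)).trans (min_le_right _ _))
      (Real.exp_pos _).le
  · have h : IntegrableOn (fun t : ℝ => Real.exp (-D * t)) (Ioi 0) :=
      integrableOn_exp_mul_Ioi (neg_lt_zero.2 hD0) 0
    refine h.mono' hm.aestronglyMeasurable (ae_of_all _ fun t => ?_)
    rw [hn]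
    exact mul_le_of_le_one_right (Real.exp_pos _).le
      ((h1 _ (Real.exp_pos _)).trans (min_le_left _ _))

/-- This is the quotient of `1/(s(1-s))` by `-ζ(s)/s` along `re s = D`. The absence of zeros on the
line enters the Tauberian argument here. -/
theorem contDiff_mellin_quotient {D : ℝ} (hD1 : D < 1)
    (hz : ∀ s : ℂ, s.re = D → riemannZeta s ≠ 0) :
    ContDiff ℝ ∞ fun ξ : ℝ => -((1 - (D + 2 * Real.pi * ξ * Complex.I)) *
      riemannZeta (D + 2 * Real.pi * ξ * Complex.I))⁻¹ := by
  rw [contDiff_iff_contDiffAt]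
  intro ξ
  set s : ℂ := D + 2 * Real.pi * ξ * Complex.I with hs
  have hre : s.re = D := by simp [hs]
  have hs1 : s ≠ 1 := by intro h; rw [h, Complex.one_re] at hre; exact hD1.ne hre.symm
  have ha : AnalyticAt ℂ (fun z => -((1 - z) * riemannZeta z)⁻¹) s := by
    have h1 : AnalyticAt ℂ riemannZeta s :=
      differentiableOn_riemannZeta.analyticAt (isOpen_compl_singleton.mem_nhds hs1)
    exact (((analyticAt_const.sub analyticAt_id).mul h1).inv
      (mul_ne_zero (sub_ne_zero.2 (Ne.symm hs1)) (hz s hre))).neg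
  have hc : ContDiffAt ℝ ∞ (fun z : ℂ => -((1 - z) * riemannZeta z)⁻¹) s :=
    (ha.contDiffAt (n := ∞)).restrict_scalars ℝ
  have hl : ContDiffAt ℝ ∞ (fun ξ : ℝ => (D : ℂ) + 2 * Real.pi * ξ * Complex.I) ξ :=
    (contDiff_const.add ((contDiff_const.mul Complex.ofRealCLM.contDiff).mul
      contDiff_const)).contDiffAt
  exact ContDiffAt.comp (g := fun z : ℂ => -((1 - z) * riemannZeta z)⁻¹) ξ hc hl

/-! ### Sufficiency: from the spectral asymptotics to Minkowski measurability. -/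

namespace FractalString

variable (L : FractalString)

theorem fractSum_nonneg (x : ℝ) : 0 ≤ L.fractSum x := tsum_nonneg fun _ => Int.fract_nonneg _

theorem fractSum_le_truncSum {x : ℝ} (hx : 0 ≤ x) : L.fractSum x ≤ L.truncSum x :=
  (L.summable_fract hx).tsum_le_tsum
    (fun j => fract_le_min (mul_nonneg hx (L.length_pos j).le)) (L.summable_min_one hx)

theorem truncSum_le_mul {x : ℝ} (hx : 0 ≤ x) : L.truncSum x ≤ x * ∑' j, L.length j := by
  rw [← tsum_mul_left]
  exact (L.summable_min_one hx).tsum_le_tsum (fun _ => min_le_right _ _)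
    (L.summable_length.mul_left x)

theorem tsum_length_nonneg : 0 ≤ ∑' j, L.length j := tsum_nonneg fun j => (L.length_pos j).le

/-- Termwise this is `min(1, 2y) ≤ min(1, y) + {y}`. It lets a bound on the fractional-part sum
control the larger sum by repeated halving. -/
theorem truncSum_le_half {x : ℝ} (hx : 0 ≤ x) :
    L.truncSum x ≤ L.truncSum (x / 2) + L.fractSum (x / 2) := by
  have hx2 : 0 ≤ x / 2 := by positivity
  rw [truncSum, truncSum, fractSum, ← (L.summable_min_one hx2).tsum_add (L.summable_fract hx2)]
  refine (L.summable_min_one hx).tsum_le_tsum (fun j => ?_)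
    ((L.summable_min_one hx2).add (L.summable_fract hx2))
  have hy : 0 ≤ x / 2 * L.length j := mul_nonneg hx2 (L.length_pos j).le
  rw [show x * L.length j = 2 * (x / 2 * L.length j) by ring]
  set y := x / 2 * L.length j
  rcases lt_or_ge y 1 with h | h
  · rw [Int.fract_eq_self.2 ⟨hy, h⟩, min_eq_right h.le]
    exact (min_le_right _ _).trans (by linarith)
  · rw [min_eq_left h]
    exact (min_le_left _ _).trans (le_add_of_nonneg_right (Int.fract_nonneg _))

/-- A power bound for all `x` from one for large `x`. -/
theorem exists_fractSum_le {D C : ℝ} (hD1 : D < 1)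
    (hC : Tendsto (fun x : ℝ => x ^ (-D) * L.fractSum x) atTop (𝓝 C)) :
    ∃ A, ∀ x, 0 < x → L.fractSum x ≤ A * x ^ D := by
  obtain ⟨x₀, hx₀⟩ := eventually_atTop.1 (hC.eventually (gt_mem_nhds (lt_add_one C)))
  refine ⟨max (C + 1) ((max x₀ 1) ^ (1 - D) * ∑' j, L.length j), fun x hx => ?_⟩
  have hxD := Real.rpow_pos_of_pos hx D
  rcases le_or_gt x₀ x with h | h
  · have := (hx₀ x h).le
    rw [Real.rpow_neg hx.le, inv_mul_le_iff₀ hxD] at this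
    rw [mul_comm]
    exact this.trans (mul_le_mul_of_nonneg_left (le_max_left _ _) hxD.le)
  · refine ((L.fractSum_le_truncSum hx.le).trans (L.truncSum_le_mul hx.le)).trans ?_
    have e : x = x ^ (1 - D) * x ^ D := by rw [← Real.rpow_add hx]; simp
    have h1 : x ^ (1 - D) ≤ (max x₀ 1) ^ (1 - D) :=
      Real.rpow_le_rpow hx.le (h.le.trans (le_max_left _ _)) (by linarith)
    calc x * ∑' j, L.length j = x ^ (1 - D) * (∑' j, L.length j) * x ^ D := by
          nth_rewrite 1 [e]; ring
      _ ≤ ((max x₀ 1) ^ (1 - D) * ∑' j, L.length j) * x ^ D :=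
          mul_le_mul_of_nonneg_right (mul_le_mul_of_nonneg_right h1 L.tsum_length_nonneg) hxD.le
      _ ≤ _ := mul_le_mul_of_nonneg_right (le_max_right _ _) hxD.le

/-- Dyadic induction: the linear bound starts it on `x ≤ 1`, and the halving step closes because `M`
is chosen with `M + A ≤ 2^D M`. -/
theorem exists_truncSum_le {D A : ℝ} (hD0 : 0 < D) (hD1 : D < 1)
    (hA : ∀ x, 0 < x → L.fractSum x ≤ A * x ^ D) :
    ∃ M, ∀ x, 0 < x → L.truncSum x ≤ M * x ^ D := by
  set Λ := ∑' j, L.length j with hΛ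
  have h2 : 1 < (2 : ℝ) ^ D := Real.one_lt_rpow one_lt_two hD0
  set M := max Λ (A / (2 ^ D - 1)) with hM
  have hMA : A ≤ (2 ^ D - 1) * M := by
    rw [mul_comm, ← div_le_iff₀ (sub_pos.2 h2)]
    exact le_max_right _ _
  have key : ∀ n : ℕ, ∀ x, 0 < x → x ≤ 2 ^ n → L.truncSum x ≤ M * x ^ D := by
    intro n
    induction n with
    | zero =>
      intro x hx hx1
      rw [pow_zero] at hx1
      have h1 : x ≤ x ^ D := by
        simpa using Real.rpow_le_rpow_of_exponent_ge hx hx1 hD1.le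
      calc L.truncSum x ≤ x * Λ := L.truncSum_le_mul hx.le
        _ ≤ x ^ D * M := mul_le_mul h1 (le_max_left _ _) L.tsum_length_nonneg (by positivity)
        _ = M * x ^ D := mul_comm _ _
    | succ n ih =>
      intro x hx hxn
      have hx2 : 0 < x / 2 := by positivity
      have := ih (x / 2) hx2 (by rw [pow_succ] at hxn; linarith)
      have hpos := Real.rpow_pos_of_pos hx2 D
      have e : x ^ D = 2 ^ D * (x / 2) ^ D := by
        rw [← Real.mul_rpow (by norm_num) hx2.le]; congr 1; ring
      calc L.truncSum x ≤ M * (x / 2) ^ D + A * (x / 2) ^ D :=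
            (L.truncSum_le_half hx.le).trans (add_le_add this (hA _ hx2))
        _ ≤ M * (x / 2) ^ D + ((2 ^ D - 1) * M) * (x / 2) ^ D := by gcongr
        _ = M * x ^ D := by rw [e]; ring
  refine ⟨M, fun x hx => ?_⟩
  obtain ⟨n, hn⟩ := pow_unbounded_of_one_lt x one_lt_two
  exact key n x hx hn.le

theorem truncSum_mono {x y : ℝ} (hx : 0 ≤ x) (hxy : x ≤ y) : L.truncSum x ≤ L.truncSum y :=
  (L.summable_min_one hx).tsum_le_tsum
    (fun j => min_le_min_left _ (mul_le_mul_of_nonneg_right hxy (L.length_pos j).le))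
    (L.summable_min_one (hx.trans hxy))

theorem truncSum_mul_le {x a : ℝ} (hx : 0 ≤ x) (ha : 1 ≤ a) :
    L.truncSum (a * x) ≤ a * L.truncSum x := by
  have ha0 : 0 ≤ a := zero_le_one.trans ha
  rw [truncSum, truncSum, ← tsum_mul_left]
  refine (L.summable_min_one (mul_nonneg ha0 hx)).tsum_le_tsum (fun j => ?_)
    ((L.summable_min_one hx).mul_left a)
  rw [mul_min_of_nonneg _ _ ha0, mul_one, mul_assoc]
  exact min_le_min_right _ ha

theorem truncSum_nonneg {x : ℝ} (hx : 0 ≤ x) : 0 ≤ L.truncSum x :=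
  tsum_nonneg fun j => le_min zero_le_one (mul_nonneg hx (L.length_pos j).le)

/-- The normalized sum is Lipschitz in logarithmic scale. -/
theorem abs_sub_truncSum_le {D M : ℝ} (hD0 : 0 < D) (hD1 : D < 1)
    (hM : ∀ t, Real.exp (-D * t) * L.truncSum (Real.exp t) ≤ M) (t u : ℝ) :
    |Real.exp (-D * t) * L.truncSum (Real.exp t) -
      Real.exp (-D * (t - u)) * L.truncSum (Real.exp (t - u))| ≤ M * |u| := by
  have hn : ∀ t, 0 ≤ Real.exp (-D * t) * L.truncSum (Real.exp t) := fun t =>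
    mul_nonneg (Real.exp_pos _).le (L.truncSum_nonneg (Real.exp_pos _).le)
  have hM0 : 0 ≤ M := (hn 0).trans (hM 0)
  have key : ∀ t v : ℝ, 0 ≤ v →
      |Real.exp (-D * (t + v)) * L.truncSum (Real.exp (t + v)) -
        Real.exp (-D * t) * L.truncSum (Real.exp t)| ≤ M * v := by
    intro t v hv
    -- `truncSum x` increases while `truncSum x / x` decreases. These bound the normalized sum at `t
    -- + v` below and above by its value at `t` up to exponential factors, and `1 - a ≤ e^(-a)`
    -- linearizes both.
    have h1 : Real.exp (-D * v) * (Real.exp (-D * t) * L.truncSum (Real.exp t)) ≤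
        Real.exp (-D * (t + v)) * L.truncSum (Real.exp (t + v)) := by
      rw [← mul_assoc, ← Real.exp_add, show -D * v + -D * t = -D * (t + v) by ring]
      exact mul_le_mul_of_nonneg_left (L.truncSum_mono (Real.exp_pos _).le
        (Real.exp_le_exp.2 (by linarith))) (Real.exp_pos _).le
    have h2 : Real.exp (-(1 - D) * v) * (Real.exp (-D * (t + v)) * L.truncSum (Real.exp (t + v))) ≤
        Real.exp (-D * t) * L.truncSum (Real.exp t) := by
      have := L.truncSum_mul_le (Real.exp_pos t).le (Real.one_le_exp hv)
      rw [← Real.exp_add, add_comm v t] at this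
      calc _ = Real.exp (-D * t) * (Real.exp (-v) * L.truncSum (Real.exp (t + v))) := by
            rw [← mul_assoc, ← mul_assoc, ← Real.exp_add, ← Real.exp_add]; ring_nf
        _ ≤ _ := by
            refine mul_le_mul_of_nonneg_left ?_ (Real.exp_pos _).le
            rw [Real.exp_neg, inv_mul_le_iff₀ (Real.exp_pos v)]
            exact this
    have e1 := Real.add_one_le_exp (-D * v)
    have e2 := Real.add_one_le_exp (-(1 - D) * v)
    have a1 := hn t
    have a2 := hM t
    have b1 := hn (t + v)
    have b2 := hM (t + v)
    have c1 := mul_le_mul_of_nonneg_right e1 a1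
    have c2 := mul_le_mul_of_nonneg_right e2 b1
    set X := Real.exp (-D * t) * L.truncSum (Real.exp t)
    set Y := Real.exp (-D * (t + v)) * L.truncSum (Real.exp (t + v))
    have d1 : D * v * X ≤ M * v := by
      have : D * v ≤ v := mul_le_of_le_one_left hv hD1.le
      calc D * v * X ≤ v * M := mul_le_mul this a2 a1 hv
        _ = _ := mul_comm _ _
    have d2 : (1 - D) * v * Y ≤ M * v := by
      have : (1 - D) * v ≤ v := mul_le_of_le_one_left hv (by linarith)
      calc (1 - D) * v * Y ≤ v * M := mul_le_mul this b2 b1 hv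
        _ = _ := mul_comm _ _
    rw [abs_le]
    constructor <;> linarith
  rcases le_total 0 u with hu | hu
  · have := key (t - u) u hu
    rw [sub_add_cancel] at this
    rwa [abs_of_nonneg hu]
  · have := key t (-u) (neg_nonneg.2 hu)
    rw [← sub_eq_add_neg, abs_sub_comm] at this
    rwa [abs_of_nonpos hu]

/-- Exhibits the normalized sums as sums of shifted kernels, with weight `ℓⱼ^D` at the point `-log
ℓⱼ`. -/
theorem rpow_length_mul_shift (q : ℝ → ℝ) (D t : ℝ) (j : ℕ) :
    L.length j ^ D * (Real.exp (-D * (t - -Real.log (L.length j))) *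
      q (Real.exp (t - -Real.log (L.length j)))) =
      Real.exp (-D * t) * q (Real.exp t * L.length j) := by
  have h := L.length_pos j
  rw [sub_neg_eq_add, Real.exp_add, Real.exp_log h, mul_add, Real.exp_add, Real.rpow_def_of_pos h]
  have : Real.exp (Real.log (L.length j) * D) * Real.exp (-D * Real.log (L.length j)) = 1 := by
    rw [← Real.exp_add]; simp [mul_comm]
  linear_combination (Real.exp (-D * t) * q (Real.exp t * L.length j)) * this

/-- If `ζ` has no zeros on the line `re s = D`, then the asymptotics of the sum of fractional parts
determine those of `truncSum`. -/
theorem exists_tendsto_truncSum {D C : ℝ} (hD0 : 0 < D) (hD1 : D < 1)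
    (hz : ∀ s : ℂ, s.re = D → riemannZeta s ≠ 0) (hC0 : C ≠ 0)
    (hC : Tendsto (fun x : ℝ => x ^ (-D) * L.fractSum x) atTop (𝓝 C)) :
    ∃ c : ℝ, 0 < c ∧ Tendsto (fun x : ℝ => x ^ (-D) * L.truncSum x) atTop (𝓝 c) := by
  obtain ⟨A, hA⟩ := L.exists_fractSum_le hD1 hC
  obtain ⟨M, hM⟩ := L.exists_truncSum_le hD0 hD1 hA
  have hexp : ∀ t, Real.exp (-D * t) = (Real.exp t) ^ (-D) := fun t => by
    rw [← Real.exp_mul]; ring_nf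
  have hM' : ∀ t, Real.exp (-D * t) * L.truncSum (Real.exp t) ≤ M := by
    intro t
    rw [hexp, Real.rpow_neg (Real.exp_pos _).le, inv_mul_le_iff₀ (Real.rpow_pos_of_pos (Real.exp_pos _) _),
      mul_comm]
    exact hM _ (Real.exp_pos _)
  set k : ℝ → ℝ := fun t => Real.exp (-D * t) * Int.fract (Real.exp t) with hk
  set m : ℝ → ℝ := fun t => Real.exp (-D * t) * min 1 (Real.exp t) with hm
  set w : ℕ → ℝ := fun j => L.length j ^ D with hw
  set b : ℕ → ℝ := fun j => -Real.log (L.length j) with hb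
  have ek : ∀ t j, w j * k (t - b j) = Real.exp (-D * t) * Int.fract (Real.exp t * L.length j) :=
    fun t j => L.rpow_length_mul_shift Int.fract D t j
  have em : ∀ t j, w j * m (t - b j) = Real.exp (-D * t) * min 1 (Real.exp t * L.length j) :=
    fun t j => L.rpow_length_mul_shift (fun y => min 1 y) D t j
  have sk : ∀ t, ∑' j, w j * k (t - b j) = Real.exp (-D * t) * L.fractSum (Real.exp t) :=
    fun t => by rw [tsum_congr (ek t), tsum_mul_left, fractSum]
  have sm : ∀ t, ∑' j, w j * m (t - b j) = Real.exp (-D * t) * L.truncSum (Real.exp t) :=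
    fun t => by rw [tsum_congr (em t), tsum_mul_left, truncSum]
  have hkm : ∀ t, Real.exp (-D * t) * L.fractSum (Real.exp t) ≤
      Real.exp (-D * t) * L.truncSum (Real.exp t) := fun t =>
    mul_le_mul_of_nonneg_left (L.fractSum_le_truncSum (Real.exp_pos _).le) (Real.exp_pos _).le
  have hCt : Tendsto (fun t => Real.exp (-D * t) * L.fractSum (Real.exp t)) atTop (𝓝 C) := by
    simp_rw [hexp]
    exact hC.comp Real.tendsto_exp_atTop
  have hmain : ∃ c : ℝ, Tendsto (fun t => ∑' j, w j * m (t - b j)) atTop (𝓝 c) := by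
    refine exists_tendsto_tsum_shift (k := k) (M := M) (B := M) (C := C) ?_ ?_ ?_ ?_ ?_ ?_
      (contDiff_mellin_quotient hD1 hz) ?_ ?_ ?_ ?_ ?_ ?_ ?_ ?_
    · exact (by fun_prop : Measurable fun t : ℝ => Real.exp (-D * t)).mul
        (measurable_fract.comp Real.measurable_exp)
    · exact fun t => mul_nonneg (Real.exp_pos _).le (Int.fract_nonneg _)
    · exact integrable_exp_mul_comp_exp measurable_fract hD0 hD1 (fun _ _ => Int.fract_nonneg _)
        fun y hy => fract_le_min hy.le
    · fun_prop
    · exact fun t => by positivity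
    · exact integrable_exp_mul_comp_exp (q := fun y => min 1 y) (by fun_prop) hD0 hD1
        (fun y hy => by positivity) fun y hy => le_rfl
    · intro ξ
      set s : ℂ := D + 2 * Real.pi * ξ * Complex.I with hs
      have hre : s.re = D := by simp [hs]
      have hs0 : s ≠ 0 := by intro h; rw [h, Complex.zero_re] at hre; exact hD0.ne hre
      have hs1 : 1 - s ≠ 0 := by
        rw [sub_ne_zero]
        intro h; rw [← h, Complex.one_re] at hre; exact hD1.ne hre.symm
      rw [fourier_exp_mul_comp_exp Int.fract, fourier_exp_mul_comp_exp (fun y => min 1 y), ← hs,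
        mellin_fract_inv (by rwa [hre]) (by rwa [hre]),
        mellin_min_one_inv (by rwa [hre]) (by rwa [hre])]
      have := hz s hre
      field_simp
    · exact fun j => (Real.rpow_pos_of_pos (L.length_pos j) D).le
    · intro t
      simp_rw [ek]
      exact (L.summable_fract (Real.exp_pos t).le).mul_left _
    · exact fun t => by rw [sk]; exact (hkm t).trans (hM' t)
    · intro t
      simp_rw [em]
      exact (L.summable_min_one (Real.exp_pos t).le).mul_left _
    · exact fun t => by rw [sm]; exact hM' t
    · intro t u
      rw [sm, sm]
      exact L.abs_sub_truncSum_le hD0 hD1 hM' t u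
    · simp_rw [sk]
      exact hCt
  obtain ⟨c, hc⟩ := hmain
  simp_rw [sm, hexp] at hc
  have hc' : Tendsto (fun x : ℝ => x ^ (-D) * L.truncSum x) atTop (𝓝 c) := by
    refine (hc.comp Real.tendsto_log_atTop).congr' ?_
    filter_upwards [eventually_gt_atTop 0] with x hx
    simp only [Function.comp_apply, Real.exp_log hx]
  refine ⟨c, ?_, hc'⟩
  -- Positivity of the limit: `0 < C ≤ c`, since the fractional-part sum is nonnegative and
  -- dominated by `truncSum`.
  have hC0' : 0 ≤ C := ge_of_tendsto hC (by
    filter_upwards [eventually_gt_atTop 0] with x hx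
    exact mul_nonneg (Real.rpow_nonneg hx.le _) (L.fractSum_nonneg x))
  refine (lt_of_le_of_ne hC0' (Ne.symm hC0)).trans_le (le_of_tendsto_of_tendsto hC hc' ?_)
  filter_upwards [eventually_gt_atTop 0] with x hx
  exact mul_le_mul_of_nonneg_left (L.fractSum_le_truncSum hx.le) (Real.rpow_nonneg hx.le _)

theorem tendsto_inv_two_mul : Tendsto (fun ε : ℝ => (2 * ε)⁻¹) (𝓝[>] 0) atTop := by
  refine tendsto_inv_nhdsGT_zero.comp (tendsto_nhdsWithin_iff.2 ⟨?_, ?_⟩)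
  · have : Tendsto (fun ε : ℝ => 2 * ε) (𝓝 0) (𝓝 (2 * 0)) := tendsto_id.const_mul 2
    rw [mul_zero] at this
    exact this.mono_left nhdsWithin_le_nhds
  · filter_upwards [self_mem_nhdsWithin] with ε hε
    exact mul_pos two_pos (show 0 < ε from hε)

theorem minkowskiMeasurable_of_tendsto {c : ℝ} (hc : 0 < c)
    (h : Tendsto (fun x : ℝ => x ^ (-L.dimension) * L.truncSum x) atTop (𝓝 c)) :
    L.MinkowskiMeasurable := by
  set D := L.dimension with hD
  have ht : Tendsto (fun ε => L.contentRatio D ε) (𝓝[>] 0)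
      (𝓝 (ENNReal.ofReal (2 ^ (1 - D) * c))) := by
    refine (ENNReal.tendsto_ofReal ((h.comp tendsto_inv_two_mul).const_mul _)).congr' ?_
    filter_upwards [self_mem_nhdsWithin] with ε hε
    rw [L.contentRatio_eq D hε]
    rfl
  have h1 : L.lowerContent D = ENNReal.ofReal (2 ^ (1 - D) * c) := ht.liminf_eq
  have h2 : L.upperContent D = ENNReal.ofReal (2 ^ (1 - D) * c) := ht.limsup_eq
  refine ⟨?_, ?_, ?_⟩
  · rw [← hD, h1, ENNReal.ofReal_pos]
    positivity
  · rw [← hD, h2]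
    exact ENNReal.ofReal_lt_top
  · rw [← hD, h1, h2]

end FractalString

theorem inverseSpectralProblem_of_riemannZeta_ne_zero {D : ℝ} (hD0 : 0 < D) (hD1 : D < 1)
    (hz : ∀ s : ℂ, s.re = D → riemannZeta s ≠ 0) : InverseSpectralProblem D := by
  intro L hL h
  obtain ⟨C, hC0, hC⟩ := (L.hasMonotonicSecondTerm_iff D).1 h
  obtain ⟨c, hc0, hc⟩ := L.exists_tendsto_truncSum hD0 hD1 hz hC0 hC
  exact L.minkowskiMeasurable_of_tendsto hc0 (by rwa [hL])

/-! ### Necessity: comparison of sums with integrals. -/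

/-- Comparison of a sum with an integral for a function whose oscillation is controlled by a
decreasing majorant beyond `J`. -/
theorem abs_tsum_sub_integral_le {P T : ℝ → ℝ} {J : ℕ} (hJ : 1 ≤ J)
    (hP : IntegrableOn P (Ioi 0)) (hP0 : ∀ v, 0 < v → 0 ≤ P v) (hP1 : ∀ v, 0 < v → P v ≤ 1)
    (hT0 : ∀ v, 0 < v → 0 ≤ T v) (hT : ∀ v v', (J : ℝ) ≤ v → v ≤ v' → |P v - P v'| ≤ T v - T v')
    (hs : Summable fun j : ℕ => P (j + 1)) :
    |∑' j : ℕ, P (j + 1) - ∫ v in Ioi 0, P v| ≤ J + T J := by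
  have hii : ∀ a b : ℝ, 0 ≤ a → a ≤ b → IntervalIntegrable P volume a b := fun a b ha hab =>
    (intervalIntegrable_iff_integrableOn_Ioc_of_le hab).2
      (hP.mono_set fun x hx => ha.trans_lt hx.1)
  have hcell : ∀ (j : ℕ) (B : ℝ), (∀ v ∈ Ioc (j : ℝ) (j + 1), |P (j + 1) - P v| ≤ B) →
      |P (j + 1) - ∫ v in (j : ℝ)..(j + 1), P v| ≤ B := by
    intro j B hB
    have hle : (j : ℝ) ≤ j + 1 := by linarith
    have e : P (j + 1) - ∫ v in (j : ℝ)..(j + 1), P v = ∫ v in (j : ℝ)..(j + 1), (P (j + 1) - P v) := by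
      rw [intervalIntegral.integral_sub intervalIntegrable_const
        (hii _ _ (Nat.cast_nonneg j) hle)]
      simp
    rw [e]
    have := intervalIntegral.norm_integral_le_of_norm_le_const (a := (j : ℝ)) (b := j + 1)
      (f := fun v => P (j + 1) - P v) (C := B) (by rw [uIoc_of_le hle]; exact hB)
    simpa using this
  have hsucc : ∀ N : ℕ, (∑ j ∈ Finset.range (N + 1), P (j + 1)) - ∫ v in (0 : ℝ)..(N + 1 : ℕ), P v =
      ((∑ j ∈ Finset.range N, P (j + 1)) - ∫ v in (0 : ℝ)..N, P v) +
        (P (N + 1) - ∫ v in (N : ℝ)..(N + 1), P v) := by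
    intro N
    rw [Finset.sum_range_succ, Nat.cast_succ, ← intervalIntegral.integral_add_adjacent_intervals
      (hii 0 N le_rfl (Nat.cast_nonneg N)) (hii N (N + 1) (Nat.cast_nonneg N) (by linarith))]
    ring
  -- Since `0 ≤ P ≤ 1`, each unit cell costs at most `1`; this is used for the first `J` cells.
  have h1 : ∀ N : ℕ, |(∑ j ∈ Finset.range N, P (j + 1)) - ∫ v in (0 : ℝ)..N, P v| ≤ N := by
    intro N
    induction N with
    | zero => simp
    | succ N ih =>
      rw [hsucc]
      refine (abs_add_le _ _).trans ?_
      rw [Nat.cast_succ]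
      refine add_le_add ih (hcell N 1 fun v hv => ?_)
      have hv0 : 0 < v := (Nat.cast_nonneg N).trans_lt hv.1
      have hN0 : (0 : ℝ) < N + 1 := by positivity
      rw [abs_le]
      constructor <;> linarith [hP0 v hv0, hP1 v hv0, hP0 _ hN0, hP1 _ hN0]
  -- Beyond `J` a cell costs at most the drop of `T` across it, and the drops telescope.
  have h2 : ∀ N : ℕ, J ≤ N →
      |(∑ j ∈ Finset.range N, P (j + 1)) - ∫ v in (0 : ℝ)..N, P v| ≤ J + T J - T N := by
    intro N hN
    induction N, hN using Nat.le_induction with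
    | base => simpa using h1 J
    | succ N hN ih =>
      rw [hsucc]
      refine (abs_add_le _ _).trans ?_
      have hJN : (J : ℝ) ≤ N := by exact_mod_cast hN
      have hTmono : ∀ v v', (J : ℝ) ≤ v → v ≤ v' → T v' ≤ T v := fun v v' h h' => by
        linarith [(abs_nonneg _).trans (hT v v' h h')]
      have := hcell N (T N - T (N + 1)) fun v hv => by
        rw [abs_sub_comm]
        exact (hT v _ (hJN.trans hv.1.le) hv.2).trans
          (sub_le_sub_right (hTmono N v hJN hv.1.le) _)
      rw [Nat.cast_succ]
      linarith
  have hlim : Tendsto (fun N : ℕ => |(∑ j ∈ Finset.range N, P (j + 1)) - ∫ v in (0 : ℝ)..N, P v|)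
      atTop (𝓝 |∑' j : ℕ, P (j + 1) - ∫ v in Ioi 0, P v|) :=
    (hs.hasSum.tendsto_sum_nat.sub
      (intervalIntegral_tendsto_integral_Ioi 0 hP tendsto_natCast_atTop_atTop)).abs
  refine le_of_tendsto hlim ?_
  filter_upwards [eventually_ge_atTop J] with N hN
  have hN0 : (0 : ℝ) < N := by exact_mod_cast (show 0 < N by omega)
  linarith [h2 N hN, hT0 N hN0]

/-! ### The oscillating counting function and its inverse. -/

/-- The model counting function `y ^ D + a re (y ^ s)`, where `a = D / (2 |s|)`. -/
def modelCount (D : ℝ) (s : ℂ) (y : ℝ) : ℝ := y ^ D + D / (2 * ‖s‖) * ((y : ℂ) ^ s).re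

/-- The derivative of `modelCount`. -/
def modelDensity (D : ℝ) (s : ℂ) (y : ℝ) : ℝ :=
  D * y ^ (D - 1) + D / (2 * ‖s‖) * (s * (y : ℂ) ^ (s - 1)).re

section Model

variable {D : ℝ} {s : ℂ}

theorem hasDerivAt_modelCount {y : ℝ} (hy : 0 < y) :
    HasDerivAt (modelCount D s) (modelDensity D s y) y := by
  have h1 : HasDerivAt (fun y : ℝ => y ^ D) (D * y ^ (D - 1)) y :=
    Real.hasDerivAt_rpow_const (Or.inl hy.ne')
  have h2 : HasDerivAt (fun y : ℝ => (y : ℂ) ^ s) (s * (y : ℂ) ^ (s - 1)) y := by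
    have := ((hasDerivAt_id (y : ℂ)).cpow_const (c := s) (Or.inl (by simpa using hy))).comp_ofReal
    simpa using this
  have h3 : HasDerivAt (fun y : ℝ => ((y : ℂ) ^ s).re) (s * (y : ℂ) ^ (s - 1)).re y :=
    Complex.reCLM.hasFDerivAt.comp_hasDerivAt y h2
  exact h1.add (h3.const_mul _)

theorem abs_model_coeff_mul_re_le (hD0 : 0 < D) (hs : s.re = D) {y : ℝ} (hy : 0 < y) :
    |D / (2 * ‖s‖) * ((y : ℂ) ^ s).re| ≤ y ^ D / 2 := by
  have hDs : D ≤ ‖s‖ := hs ▸ Complex.re_le_norm s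
  have hs0 : 0 < ‖s‖ := hD0.trans_le hDs
  rw [abs_mul, abs_of_pos (by positivity)]
  have h1 : |((y : ℂ) ^ s).re| ≤ y ^ D := by
    have := Complex.abs_re_le_norm ((y : ℂ) ^ s)
    rwa [Complex.norm_cpow_eq_rpow_re_of_pos hy, hs] at this
  have h2 : D / (2 * ‖s‖) ≤ 1 / 2 := by
    rw [div_le_div_iff₀ (by positivity) two_pos]
    linarith
  calc _ ≤ 1 / 2 * y ^ D := mul_le_mul h2 h1 (abs_nonneg _) (by norm_num)
    _ = _ := by ring

theorem modelCount_bounds (hD0 : 0 < D) (hs : s.re = D) {y : ℝ} (hy : 0 < y) :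
    y ^ D / 2 ≤ modelCount D s y ∧ modelCount D s y ≤ 3 / 2 * y ^ D := by
  have := abs_le.1 (abs_model_coeff_mul_re_le hD0 hs hy)
  rw [modelCount]
  constructor <;> linarith [this.1, this.2]

/-- The coefficient `D / (2|s|)` makes the oscillating part at most half of `D y^(D-1)`, so the
model count is strictly increasing and can be inverted. -/
theorem modelDensity_pos (hD0 : 0 < D) (hs : s.re = D) {y : ℝ} (hy : 0 < y) :
    0 < modelDensity D s y := by
  have hs0 : 0 < ‖s‖ := hD0.trans_le (hs ▸ Complex.re_le_norm s)
  have h1 : |(s * (y : ℂ) ^ (s - 1)).re| ≤ ‖s‖ * y ^ (D - 1) := by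
    have := Complex.abs_re_le_norm (s * (y : ℂ) ^ (s - 1))
    rwa [norm_mul, Complex.norm_cpow_eq_rpow_re_of_pos hy, Complex.sub_re, hs, Complex.one_re] at this
  have h2 := (abs_le.1 h1).1
  have h3 : D / (2 * ‖s‖) * -(‖s‖ * y ^ (D - 1)) ≤
      D / (2 * ‖s‖) * (s * (y : ℂ) ^ (s - 1)).re :=
    mul_le_mul_of_nonneg_left h2 (by positivity)
  have h4 : D / (2 * ‖s‖) * -(‖s‖ * y ^ (D - 1)) = -(D / 2 * y ^ (D - 1)) := by field_simp
  have h5 : 0 < D / 2 * y ^ (D - 1) := by positivity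
  rw [modelDensity]
  linarith

theorem strictMonoOn_modelCount (hD0 : 0 < D) (hs : s.re = D) :
    StrictMonoOn (modelCount D s) (Ioi 0) := by
  refine strictMonoOn_of_deriv_pos (convex_Ioi 0)
    (fun y hy => (hasDerivAt_modelCount hy).continuousAt.continuousWithinAt) fun y hy => ?_
  rw [interior_Ioi] at hy
  rw [(hasDerivAt_modelCount hy).deriv]
  exact modelDensity_pos hD0 hs hy

theorem image_modelCount (hD0 : 0 < D) (hs : s.re = D) :
    modelCount D s '' Ioi 0 = Ioi 0 := by
  refine Subset.antisymm ?_ fun v (hv : 0 < v) => ?_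
  · rintro _ ⟨y, hy : 0 < y, rfl⟩
    exact lt_of_lt_of_le (by positivity) (modelCount_bounds hD0 hs hy).1
  · have hpow : ∀ c : ℝ, 0 < c → 0 < (c * v) ^ D⁻¹ ∧ ((c * v) ^ D⁻¹) ^ D = c * v := fun c hc =>
      ⟨by positivity, Real.rpow_inv_rpow (by positivity) hD0.ne'⟩
    obtain ⟨ha, ha'⟩ := hpow (2 / 3) (by norm_num)
    obtain ⟨hb, hb'⟩ := hpow 2 (by norm_num)
    have hab : (2 / 3 * v) ^ D⁻¹ ≤ (2 * v) ^ D⁻¹ :=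
      Real.rpow_le_rpow (by positivity) (by linarith) (by positivity)
    have hc : ContinuousOn (modelCount D s) (Icc ((2 / 3 * v) ^ D⁻¹) ((2 * v) ^ D⁻¹)) := fun y hy =>
      (hasDerivAt_modelCount (ha.trans_le hy.1)).continuousAt.continuousWithinAt
    have h1 := (modelCount_bounds hD0 hs ha).2
    have h2 := (modelCount_bounds hD0 hs hb).1
    rw [ha'] at h1
    rw [hb'] at h2
    obtain ⟨y, hy, hy'⟩ := intermediate_value_Icc hab hc
      (show v ∈ Icc _ _ from ⟨by linarith, by linarith⟩)
    exact ⟨y, ha.trans_le hy.1, hy'⟩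

/-- The inverse of `modelCount` on the positive half-line. -/
def modelInv (D : ℝ) (s : ℂ) : ℝ → ℝ := Function.invFunOn (modelCount D s) (Ioi 0)

theorem modelInv_pos (hD0 : 0 < D) (hs : s.re = D) {v : ℝ} (hv : 0 < v) : 0 < modelInv D s v := by
  have h : v ∈ modelCount D s '' Ioi 0 := by rw [image_modelCount hD0 hs]; exact hv
  exact Function.invFunOn_mem h

theorem modelCount_modelInv (hD0 : 0 < D) (hs : s.re = D) {v : ℝ} (hv : 0 < v) :
    modelCount D s (modelInv D s v) = v := by
  have h : v ∈ modelCount D s '' Ioi 0 := by rw [image_modelCount hD0 hs]; exact hv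
  exact Function.invFunOn_eq h

theorem modelInv_modelCount (hD0 : 0 < D) (hs : s.re = D) {y : ℝ} (hy : 0 < y) :
    modelInv D s (modelCount D s y) = y := by
  have hv : 0 < modelCount D s y := by
    have : modelCount D s y ∈ modelCount D s '' Ioi 0 := mem_image_of_mem _ hy
    rwa [image_modelCount hD0 hs] at this
  exact (strictMonoOn_modelCount hD0 hs).injOn (modelInv_pos hD0 hs hv) hy
    (modelCount_modelInv hD0 hs hv)

theorem modelInv_mono (hD0 : 0 < D) (hs : s.re = D) {v v' : ℝ} (hv : 0 < v) (h : v ≤ v') :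
    modelInv D s v ≤ modelInv D s v' := by
  rw [← (strictMonoOn_modelCount hD0 hs).le_iff_le (modelInv_pos hD0 hs hv)
    (modelInv_pos hD0 hs (hv.trans_le h)), modelCount_modelInv hD0 hs hv,
    modelCount_modelInv hD0 hs (hv.trans_le h)]
  exact h

/-- Follows from `modelCount ≤ (3/2) y^D`. As `1/D > 1`, it makes the lengths summable, and it also
controls the tail in the fractional-part estimate. -/
theorem inv_modelInv_le (hD0 : 0 < D) (hs : s.re = D) {v : ℝ} (hv : 0 < v) :
    (modelInv D s v)⁻¹ ≤ (2 / 3 * v) ^ (-D⁻¹) := by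
  have hp := modelInv_pos hD0 hs hv
  have h := (modelCount_bounds hD0 hs hp).2
  rw [modelCount_modelInv hD0 hs hv] at h
  rw [Real.rpow_neg (by positivity)]
  refine inv_anti₀ (by positivity) ?_
  rw [Real.rpow_inv_le_iff_of_pos (by positivity) hp.le hD0]
  linarith

/-- Change of variables from the index to the reciprocal length. -/
theorem setIntegral_comp_modelInv (hD0 : 0 < D) (hs : s.re = D) (q : ℝ → ℝ) :
    ∫ v in Ioi 0, q (modelInv D s v) = ∫ y in Ioi 0, modelDensity D s y * q y := by
  rw [← image_modelCount hD0 hs, integral_image_eq_integral_abs_deriv_smul measurableSet_Ioi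
    (fun y hy => (hasDerivAt_modelCount hy).hasDerivWithinAt)
    (strictMonoOn_modelCount hD0 hs).injOn, image_modelCount hD0 hs]
  refine setIntegral_congr_fun measurableSet_Ioi fun y hy => ?_
  simp only [smul_eq_mul, modelInv_modelCount hD0 hs hy, abs_of_pos (modelDensity_pos hD0 hs hy)]

theorem integrableOn_comp_modelInv (hD0 : 0 < D) (hs : s.re = D) {q : ℝ → ℝ}
    (hq : IntegrableOn (fun y => modelDensity D s y * q y) (Ioi 0)) :
    IntegrableOn (fun v => q (modelInv D s v)) (Ioi 0) := by
  rw [← image_modelCount hD0 hs, integrableOn_image_iff_integrableOn_abs_deriv_smul measurableSet_Ioi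
    (fun y hy => (hasDerivAt_modelCount hy).hasDerivWithinAt)
    (strictMonoOn_modelCount hD0 hs).injOn]
  refine hq.congr_fun (fun y hy => ?_) measurableSet_Ioi
  simp only [smul_eq_mul, modelInv_modelCount hD0 hs hy, abs_of_pos (modelDensity_pos hD0 hs hy)]

theorem ofReal_inv_cpow_neg {x : ℝ} (hx : 0 < x) (z : ℂ) :
    ((x⁻¹ : ℝ) : ℂ) ^ (-z) = (x : ℂ) ^ z := by
  rw [Complex.ofReal_inv, Complex.inv_cpow _ _ (by
    rw [Complex.arg_ofReal_of_nonneg hx.le]; exact Real.pi_pos.ne), Complex.cpow_neg, inv_inv]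

/-- The integral of a dilated function against `modelDensity`, in terms of Mellin transforms. -/
theorem integral_modelDensity_mul {q : ℝ → ℝ} {x : ℝ} (hx : 0 < x)
    (hqD : MellinConvergent (fun y => (q y : ℂ)) D) (hqs : MellinConvergent (fun y => (q y : ℂ)) s) :
    IntegrableOn (fun y => modelDensity D s y * q (y * x⁻¹)) (Ioi 0) ∧
    ∫ y in Ioi 0, modelDensity D s y * q (y * x⁻¹) =
      D * x ^ D * (mellin (fun y => (q y : ℂ)) D).re +
        D / (2 * ‖s‖) * (s * (x : ℂ) ^ s * mellin (fun y => (q y : ℂ)) s).re := by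
  have hx' : 0 < x⁻¹ := inv_pos.2 hx
  have hc : ∀ z : ℂ, MellinConvergent (fun y => (q y : ℂ)) z →
      IntegrableOn (fun y : ℝ => (y : ℂ) ^ (z - 1) * (q (y * x⁻¹) : ℂ)) (Ioi 0) ∧
      ∫ y in Ioi (0:ℝ), (y : ℂ) ^ (z - 1) * (q (y * x⁻¹) : ℂ) =
        (x : ℂ) ^ z * mellin (fun y => (q y : ℂ)) z := by
    intro z hz
    constructor
    · have := (MellinConvergent.comp_mul_left (f := fun y => (q y : ℂ)) (s := z) hx').2 hz
      simpa [MellinConvergent, mul_comm x⁻¹] using this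
    · have := mellin_comp_mul_right (fun y => (q y : ℂ)) z hx'
      rw [ofReal_inv_cpow_neg hx] at this
      simpa [mellin] using! this
  obtain ⟨i1, e1⟩ := hc D hqD
  obtain ⟨i2, e2⟩ := hc s hqs
  have hpt : ∀ y ∈ Ioi (0:ℝ), modelDensity D s y * q (y * x⁻¹) =
      D * ((y : ℂ) ^ ((D : ℂ) - 1) * (q (y * x⁻¹) : ℂ)).re +
        D / (2 * ‖s‖) * (s * ((y : ℂ) ^ (s - 1) * (q (y * x⁻¹) : ℂ))).re := by
    intro y hy
    have : ((y : ℂ) ^ ((D : ℂ) - 1)) = ((y ^ (D - 1) : ℝ) : ℂ) := by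
      rw [Complex.ofReal_cpow (le_of_lt hy)]; simp
    rw [this, modelDensity, ← mul_assoc s, Complex.re_mul_ofReal, Complex.re_mul_ofReal,
      Complex.ofReal_re]
    ring
  have j1 : IntegrableOn (fun y : ℝ => ((y : ℂ) ^ ((D : ℂ) - 1) * (q (y * x⁻¹) : ℂ)).re) (Ioi 0) :=
    i1.re
  have j2 : IntegrableOn (fun y : ℝ => (s * ((y : ℂ) ^ (s - 1) * (q (y * x⁻¹) : ℂ))).re) (Ioi 0) :=
    (i2.const_mul s).re
  have k1 : ∫ y in Ioi (0:ℝ), ((y : ℂ) ^ ((D : ℂ) - 1) * (q (y * x⁻¹) : ℂ)).re =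
      ((x : ℂ) ^ (D : ℂ) * mellin (fun y => (q y : ℂ)) D).re := by
    rw [← e1]; exact integral_re i1
  have k2 : ∫ y in Ioi (0:ℝ), (s * ((y : ℂ) ^ (s - 1) * (q (y * x⁻¹) : ℂ))).re =
      (s * ((x : ℂ) ^ s * mellin (fun y => (q y : ℂ)) s)).re := by
    rw [← e2, ← integral_const_mul]; exact integral_re (i2.const_mul s)
  refine ⟨?_, ?_⟩
  · exact IntegrableOn.congr_fun ((j1.const_mul D).add (j2.const_mul (D / (2 * ‖s‖))))
      (fun y hy => (hpt y hy).symm) measurableSet_Ioi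
  · rw [setIntegral_congr_fun measurableSet_Ioi hpt, integral_add (j1.const_mul D)
      (j2.const_mul _), integral_const_mul, integral_const_mul, k1, k2,
      ← Complex.ofReal_cpow hx.le, Complex.re_ofReal_mul]
    ring_nf

end Model

/-! ### Strings with prescribed lengths; dimension and measurability in terms of `truncSum`. -/

namespace FractalString

/-- A fractal string with prescribed lengths, its intervals placed side by side. -/
def ofLengths (l : ℕ → ℝ) (h0 : ∀ j, 0 < l j) (ha : Antitone l) (hs : Summable l) :
    FractalString where
  left j := ∑ i ∈ Finset.range j, l i
  right j := ∑ i ∈ Finset.range (j + 1), l i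
  left_lt_right j := by rw [Finset.sum_range_succ]; linarith [h0 j]
  disjoint := by
    have key : ∀ i j, i < j → Disjoint
        (Ioo (∑ k ∈ Finset.range i, l k) (∑ k ∈ Finset.range (i + 1), l k))
        (Ioo (∑ k ∈ Finset.range j, l k) (∑ k ∈ Finset.range (j + 1), l k)) := by
      intro i j hij
      have : ∑ k ∈ Finset.range (i + 1), l k ≤ ∑ k ∈ Finset.range j, l k :=
        Finset.sum_le_sum_of_subset_of_nonneg (Finset.range_mono hij) fun k _ _ => (h0 k).le
      exact Set.disjoint_left.2 fun x hx hx' => by linarith [hx.2, hx'.1]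
    intro i j hij
    rcases lt_or_gt_of_ne hij with h | h
    · exact key i j h
    · exact (key j i h).symm
  bounded := by
    refine (Metric.isBounded_Icc 0 (∑' j, l j)).subset (iUnion_subset fun j x hx => ⟨?_, ?_⟩)
    · exact (Finset.sum_nonneg fun k _ => (h0 k).le).trans hx.1.le
    · exact hx.2.le.trans (hs.sum_le_tsum _ fun k _ => (h0 k).le)
  antitone_length := by simpa [Finset.sum_range_succ] using ha

theorem length_ofLengths {l : ℕ → ℝ} (h0 : ∀ j, 0 < l j) (ha : Antitone l) (hs : Summable l)
    (j : ℕ) : (ofLengths l h0 ha hs).length j = l j := by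
  simp [length, ofLengths, Finset.sum_range_succ]

end FractalString

namespace FractalString

/-- Two-sided power bounds on `truncSum` determine the Minkowski dimension. -/
theorem dimension_eq_of_bounds (L : FractalString) {D c M : ℝ} (hD0 : 0 ≤ D) (hc : 0 < c)
    (h1 : ∀ᶠ x in atTop, c * x ^ D ≤ L.truncSum x) (h2 : ∀ᶠ x in atTop, L.truncSum x ≤ M * x ^ D) :
    L.dimension = D := by
  have hmem : L.upperContent D < ⊤ := by
    refine lt_of_le_of_lt (limsup_le_of_le (by isBoundedDefault) ?_)
      (ENNReal.ofReal_lt_top (r := 2 ^ (1 - D) * M))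
    filter_upwards [tendsto_inv_two_mul.eventually h2, self_mem_nhdsWithin] with ε hε hε0
    have hε0' : (0 : ℝ) < ε := hε0
    have hx : 0 < (2 * ε)⁻¹ := by positivity
    rw [L.contentRatio_eq D hε0]
    refine ENNReal.ofReal_le_ofReal (mul_le_mul_of_nonneg_left ?_ (by positivity))
    rw [Real.rpow_neg hx.le, inv_mul_le_iff₀ (Real.rpow_pos_of_pos hx D), mul_comm _ M]
    exact hε
  refine le_antisymm (csInf_le ⟨0, fun d hd => hd.1⟩ ⟨hD0, hmem⟩) (le_csInf ⟨D, hD0, hmem⟩ ?_)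
  rintro d ⟨hd0, hd⟩
  by_contra! hlt
  refine hd.ne ?_
  -- For `d < D` the lower bound makes the content ratio grow at least like a multiple of `x^(D-d)`,
  -- so the upper content is infinite.
  have hreal : Tendsto (fun x : ℝ => 2 ^ (1 - d) * (x ^ (-d) * L.truncSum x)) atTop atTop := by
    refine tendsto_atTop_mono' _ (f₁ := fun x => 2 ^ (1 - d) * (c * x ^ (D - d))) ?_
      (((tendsto_rpow_atTop (sub_pos.2 hlt)).const_mul_atTop hc).const_mul_atTop (by positivity))
    filter_upwards [h1, eventually_gt_atTop 0] with x hx hx0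
    refine mul_le_mul_of_nonneg_left ?_ (by positivity)
    calc c * x ^ (D - d) = x ^ (-d) * (c * x ^ D) := by
          rw [sub_eq_add_neg, Real.rpow_add hx0]; ring
      _ ≤ _ := mul_le_mul_of_nonneg_left hx (by positivity)
  have ht : Tendsto (fun ε => L.contentRatio d ε) (𝓝[>] 0) (𝓝 ⊤) := by
    refine (ENNReal.tendsto_ofReal_atTop.comp (hreal.comp tendsto_inv_two_mul)).congr' ?_
    filter_upwards [self_mem_nhdsWithin] with ε hε
    rw [L.contentRatio_eq d hε]
    rfl
  exact ht.limsup_eq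

/-- Minkowski measurability forces convergence of the normalized `truncSum`. -/
theorem MinkowskiMeasurable.exists_tendsto {L : FractalString} (h : L.MinkowskiMeasurable) :
    ∃ c : ℝ, Tendsto (fun x : ℝ => x ^ (-L.dimension) * L.truncSum x) atTop (𝓝 c) := by
  obtain ⟨_, h2, h3⟩ := h
  set D := L.dimension with hD
  have ht : Tendsto (fun ε => L.contentRatio D ε) (𝓝[>] 0) (𝓝 (L.upperContent D)) :=
    tendsto_of_liminf_eq_limsup h3 rfl
  have hinv : Tendsto (fun x : ℝ => (2 * x)⁻¹) atTop (𝓝[>] 0) :=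
    tendsto_inv_atTop_nhdsGT_zero.comp (tendsto_id.const_mul_atTop two_pos)
  have ht2 := ((ENNReal.tendsto_toReal h2.ne).comp (ht.comp hinv)).const_mul ((2 : ℝ) ^ (1 - D))⁻¹
  refine ⟨_, ht2.congr' ?_⟩
  filter_upwards [eventually_gt_atTop 0] with x hx
  have hx2 : 0 < (2 * x)⁻¹ := by positivity
  have e : (2 * (2 * x)⁻¹)⁻¹ = x := by field_simp
  have hn := L.truncSum_nonneg hx.le
  simp only [Function.comp_apply]
  rw [L.contentRatio_eq D hx2, e, ENNReal.toReal_ofReal (by positivity), inv_mul_cancel_left₀]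
  positivity

end FractalString

/-- A non-constant oscillation has no limit. -/
theorem not_tendsto_re_exp_mul {τ : ℝ} (hτ : τ ≠ 0) {z : ℂ} (hz : z ≠ 0) (l : ℝ) :
    ¬ Tendsto (fun t : ℝ => (Complex.exp (τ * t * Complex.I) * z).re) atTop (𝓝 l) := by
  intro h
  set f : ℝ → ℂ := fun t => Complex.exp (τ * t * Complex.I) * z with hf
  have hτ' : (τ : ℂ) ≠ 0 := by exact_mod_cast hτ
  -- A half-period shift negates `f`, so a limit of the real part must be `0`. A quarter-period
  -- shift multiplies by `I`, so the imaginary part tends to `0` as well, contradicting the constant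
  -- modulus `‖z‖`.
  have s1 : ∀ t, f (t + Real.pi / τ) = -f t := by
    intro t
    have : (τ : ℂ) * (t + Real.pi / τ : ℝ) * Complex.I =
        τ * t * Complex.I + Real.pi * Complex.I := by push_cast; field_simp
    simp only [hf]
    rw [this, Complex.exp_add, Complex.exp_pi_mul_I]
    ring
  have s2 : ∀ t, f (t + Real.pi / 2 / τ) = Complex.I * f t := by
    intro t
    have : (τ : ℂ) * (t + Real.pi / 2 / τ : ℝ) * Complex.I =
        τ * t * Complex.I + Real.pi / 2 * Complex.I := by push_cast; field_simp
    simp only [hf]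
    rw [this, Complex.exp_add, Complex.exp_pi_div_two_mul_I]
    ring
  have h0 : l = 0 := by
    have h' := h.comp (tendsto_atTop_add_const_right _ (Real.pi / τ) tendsto_id)
    have e : ((fun t => (f t).re) ∘ fun t : ℝ => id t + Real.pi / τ) = fun t => -(f t).re := by
      ext t; simp [s1]
    rw [e] at h'
    linarith [tendsto_nhds_unique h' h.neg]
  have him : Tendsto (fun t => (f t).im) atTop (𝓝 0) := by
    have h' := (h.comp (tendsto_atTop_add_const_right _ (Real.pi / 2 / τ) tendsto_id)).neg
    have e : (fun x => -((fun t => (f t).re) ∘ fun t : ℝ => id t + Real.pi / 2 / τ) x) =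
        fun t => (f t).im := by
      ext t; simp [s2]
    rw [e, h0, neg_zero] at h'
    exact h'
  have hre : Tendsto (fun t => (f t).re) atTop (𝓝 0) := h0 ▸ h
  have hsum := hre.abs.add him.abs
  simp only [abs_zero, add_zero] at hsum
  have hn : ∀ t, ‖f t‖ = ‖z‖ := by
    intro t
    simp only [hf]
    rw [norm_mul, ← Complex.ofReal_mul, Complex.norm_exp_ofReal_mul_I, one_mul]
  have : ‖z‖ ≤ 0 := ge_of_tendsto' hsum fun t => by
    rw [← hn t]; exact Complex.norm_le_abs_re_add_abs_im _
  exact hz (norm_le_zero_iff.1 this)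

/-! ### The counterexample string attached to a point `s` of the line. -/

namespace FractalString

section Model

variable {D : ℝ} {s : ℂ}

theorem summable_inv_modelInv (hD0 : 0 < D) (hD1 : D < 1) (hs : s.re = D) :
    Summable fun j : ℕ => (modelInv D s (j + 1))⁻¹ := by
  have h : Summable fun j : ℕ => (2 / 3 : ℝ) ^ (-D⁻¹) * ((j : ℝ) ^ D⁻¹)⁻¹ :=
    (Real.summable_nat_rpow_inv.2 ((one_lt_inv₀ hD0).2 hD1)).mul_left _
  refine ((summable_nat_add_iff 1).2 h).of_nonneg_of_le
    (fun j => (inv_pos.2 (modelInv_pos hD0 hs (by positivity))).le) fun j => ?_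
  refine (inv_modelInv_le hD0 hs (by positivity)).trans (le_of_eq ?_)
  rw [Real.mul_rpow (by norm_num) (by positivity), Real.rpow_neg (x := (j : ℝ) + 1) (by positivity)]
  push_cast
  rfl

/-- The string with lengths `1 / modelInv (j + 1)`. -/
def modelString (hD0 : 0 < D) (hD1 : D < 1) (hs : s.re = D) : FractalString :=
  ofLengths (fun j => (modelInv D s (j + 1))⁻¹)
    (fun j => inv_pos.2 (modelInv_pos hD0 hs (by positivity)))
    (fun i j hij => inv_anti₀ (modelInv_pos hD0 hs (by positivity))
      (modelInv_mono hD0 hs (by positivity) (by exact_mod_cast Nat.succ_le_succ hij)))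
    (summable_inv_modelInv hD0 hD1 hs)

theorem length_modelString (hD0 : 0 < D) (hD1 : D < 1) (hs : s.re = D) (j : ℕ) :
    (modelString hD0 hD1 hs).length j = (modelInv D s (j + 1))⁻¹ := length_ofLengths _ _ _ j

/-- Sums over the model string compared with Mellin transforms. -/
theorem abs_tsum_modelInv_sub_le (hD0 : 0 < D) (hs : s.re = D) (hD1 : D < 1) {q : ℝ → ℝ}
    (hqm : Measurable q) (hq0 : ∀ y, 0 < y → 0 ≤ q y) (hq1 : ∀ y, 0 < y → q y ≤ min 1 y⁻¹) {x : ℝ}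
    (hx : 0 < x) {J : ℕ} (hJ : 1 ≤ J) {T : ℝ → ℝ} (hT0 : ∀ v, 0 < v → 0 ≤ T v)
    (hT : ∀ v v', (J : ℝ) ≤ v → v ≤ v' →
      |q (modelInv D s v * x⁻¹) - q (modelInv D s v' * x⁻¹)| ≤ T v - T v') :
    |∑' j : ℕ, q (modelInv D s (j + 1) * x⁻¹) -
      (D * x ^ D * (mellin (fun y => (q y : ℂ)) D).re +
        D / (2 * ‖s‖) * (s * (x : ℂ) ^ s * mellin (fun y => (q y : ℂ)) s).re)| ≤ J + T J := by
  have hpos : ∀ v, 0 < v → 0 < modelInv D s v * x⁻¹ := fun v hv =>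
    mul_pos (modelInv_pos hD0 hs hv) (inv_pos.2 hx)
  obtain ⟨i, e⟩ := integral_modelDensity_mul (D := D) (s := s) hx
    (mellinConvergent_of_le_min hqm hq0 hq1 (s := (D : ℂ)) (by simpa) (by simpa))
    (mellinConvergent_of_le_min hqm hq0 hq1 (s := s) (by rwa [hs]) (by rwa [hs]))
  rw [← e, ← setIntegral_comp_modelInv hD0 hs (fun y => q (y * x⁻¹))]
  refine abs_tsum_sub_integral_le (P := fun v => q (modelInv D s v * x⁻¹)) hJ
    (integrableOn_comp_modelInv hD0 hs (q := fun y => q (y * x⁻¹)) i)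
    (fun v hv => hq0 _ (hpos v hv)) (fun v hv => (hq1 _ (hpos v hv)).trans (min_le_left _ _)) hT0 hT ?_
  refine ((summable_inv_modelInv hD0 hD1 hs).mul_right x).of_nonneg_of_le
    (fun j => hq0 _ (hpos _ (by positivity))) fun j => ?_
  refine ((hq1 _ (hpos _ (by positivity))).trans (min_le_right _ _)).trans (le_of_eq ?_)
  rw [mul_inv, inv_inv]

/-- The `min` kernel is monotone, so it can serve as its own majorant with `J = 1`; the error is
then `1 + T 1 ≤ 2`. Its Mellin transform does not vanish at `s`, so the oscillation survives. -/
theorem abs_truncSum_modelString_sub_le (hD0 : 0 < D) (hD1 : D < 1) (hs : s.re = D) {x : ℝ}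
    (hx : 0 < x) :
    |(modelString hD0 hD1 hs).truncSum x -
      ((1 - D)⁻¹ * x ^ D + D / (2 * ‖s‖) * ((x : ℂ) ^ s * (1 - s)⁻¹).re)| ≤ 2 := by
  have hs0 : s ≠ 0 := by rintro rfl; simp at hs; exact hD0.ne hs
  have hs1 : 1 - s ≠ 0 := by
    rw [sub_ne_zero]; rintro rfl; rw [Complex.one_re] at hs; exact hD1.ne hs.symm
  have hmono : ∀ v v', 0 < v → v ≤ v' →
      min 1 (modelInv D s v' * x⁻¹)⁻¹ ≤ min 1 (modelInv D s v * x⁻¹)⁻¹ := fun v v' hv h =>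
    min_le_min_left _ (inv_anti₀ (mul_pos (modelInv_pos hD0 hs hv) (inv_pos.2 hx))
      (mul_le_mul_of_nonneg_right (modelInv_mono hD0 hs hv h) (inv_pos.2 hx).le))
  have key := abs_tsum_modelInv_sub_le (q := fun y => min 1 y⁻¹) hD0 hs hD1 (by fun_prop)
    (fun y hy => by positivity) (fun y _ => le_rfl) hx le_rfl
    (T := fun v => max 0 (min 1 (modelInv D s v * x⁻¹)⁻¹)) (fun v _ => le_max_left _ _) (by
      intro v v' hv h
      rw [Nat.cast_one] at hv
      have hv0 : 0 < v := by linarith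
      have hp := modelInv_pos hD0 hs hv0
      have hp' := modelInv_pos hD0 hs (hv0.trans_le h)
      rw [max_eq_right (by positivity), max_eq_right (by positivity),
        abs_of_nonneg (sub_nonneg.2 (hmono v v' hv0 h))])
  rw [mellin_min_one_inv (s := (D : ℂ)) (by simpa) (by simpa),
    mellin_min_one_inv (s := s) (by rwa [hs]) (by rwa [hs])] at key
  have e1 : ∑' j : ℕ, min 1 (modelInv D s (j + 1) * x⁻¹)⁻¹ = (modelString hD0 hD1 hs).truncSum x := by
    rw [truncSum]
    refine tsum_congr fun j => ?_
    rw [length_modelString, mul_inv, inv_inv, mul_comm]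
  have e2 : D * x ^ D * (1 / ((D : ℂ) * (1 - D))).re = (1 - D)⁻¹ * x ^ D := by
    have : (1 / ((D : ℂ) * (1 - D))) = ((1 / (D * (1 - D)) : ℝ) : ℂ) := by push_cast; rfl
    have h1D : 1 - D ≠ 0 := (sub_pos.2 hD1).ne'
    rw [this, Complex.ofReal_re]
    field_simp
  have e3 : s * (x : ℂ) ^ s * (1 / (s * (1 - s))) = (x : ℂ) ^ s * (1 - s)⁻¹ := by field_simp
  rw [e1, e2, e3] at key
  refine key.trans ?_
  have : max 0 (min 1 (modelInv D s ((1 : ℕ) : ℝ) * x⁻¹)⁻¹) ≤ 1 :=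
    max_le zero_le_one (min_le_left _ _)
  push_cast at this ⊢
  linarith

/-- The zero of `ζ` annihilates the oscillating term. A fractional part is the difference of the
monotone functions `A` and `⌊A⌋`, so `A + ⌊A⌋` majorizes its oscillation. The cutoff `J` remains
free, to be balanced against `x`. -/
theorem abs_fractSum_modelString_sub_le (hD0 : 0 < D) (hD1 : D < 1) (hs : s.re = D)
    (hz : riemannZeta s = 0) {x : ℝ} (hx : 0 < x) {J : ℕ} (hJ : 1 ≤ J) :
    |(modelString hD0 hD1 hs).fractSum x -
      D * x ^ D * (mellin (fun y : ℝ => ((Int.fract y⁻¹ : ℝ) : ℂ)) D).re| ≤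
      J + 2 * (x * (2 / 3 * (J : ℝ)) ^ (-D⁻¹)) := by
  set A : ℝ → ℝ := fun v => (modelInv D s v * x⁻¹)⁻¹ with hA
  have hApos : ∀ v, 0 < v → 0 < A v := fun v hv =>
    inv_pos.2 (mul_pos (modelInv_pos hD0 hs hv) (inv_pos.2 hx))
  have hmono : ∀ v v', 0 < v → v ≤ v' → A v' ≤ A v := fun v v' hv h =>
    inv_anti₀ (mul_pos (modelInv_pos hD0 hs hv) (inv_pos.2 hx))
      (mul_le_mul_of_nonneg_right (modelInv_mono hD0 hs hv h) (inv_pos.2 hx).le)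
  have hJ0 : (0 : ℝ) < J := by exact_mod_cast hJ
  have key := abs_tsum_modelInv_sub_le (q := fun y => Int.fract y⁻¹) hD0 hs hD1
    (measurable_fract.comp measurable_inv) (fun y _ => Int.fract_nonneg _) fract_inv_le_min hx hJ
    (T := fun v => A v + ⌊A v⌋) (fun v hv => by
      have : (0 : ℝ) ≤ ⌊A v⌋ := by exact_mod_cast Int.floor_nonneg.2 (hApos v hv).le
      linarith [hApos v hv]) (by
      intro v v' hv h
      have h1 := hmono v v' (hJ0.trans_le hv) h
      have h2 : (⌊A v'⌋ : ℝ) ≤ ⌊A v⌋ := by exact_mod_cast Int.floor_mono h1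
      change |Int.fract (A v) - Int.fract (A v')| ≤ _
      rw [← Int.self_sub_floor, ← Int.self_sub_floor, abs_le]
      constructor <;> linarith)
  rw [mellin_fract_inv (s := s) (by rwa [hs]) (by rwa [hs]), hz] at key
  have e1 : ∑' j : ℕ, Int.fract (modelInv D s (j + 1) * x⁻¹)⁻¹ =
      (modelString hD0 hD1 hs).fractSum x := by
    rw [fractSum]
    refine tsum_congr fun j => ?_
    rw [length_modelString, mul_inv, inv_inv, mul_comm]
  rw [e1] at key
  simp only [neg_zero, zero_div, mul_zero, Complex.zero_re, add_zero] at key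
  refine key.trans ?_
  have h1 : A J ≤ x * (2 / 3 * (J : ℝ)) ^ (-D⁻¹) := by
    simp only [hA]
    rw [mul_inv, inv_inv, mul_comm]
    exact mul_le_mul_of_nonneg_left (inv_modelInv_le hD0 hs hJ0) hx.le
  have h2 : (⌊A J⌋ : ℝ) ≤ A J := Int.floor_le _
  linarith

theorem hasMonotonicSecondTerm_modelString (hD0 : 0 < D) (hD1 : D < 1) (hs : s.re = D)
    (hz : riemannZeta s = 0) : (modelString hD0 hD1 hs).HasMonotonicSecondTerm D := by
  obtain ⟨_, κ, hκ, hκ'⟩ := riemannZeta_ne_zero_of_mem_Ioo hD0 hD1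
  rw [hasMonotonicSecondTerm_iff]
  refine ⟨D * κ, (mul_pos hD0 hκ).ne', Metric.tendsto_atTop.2 fun ε hε => ?_⟩
  have hδ : 0 < ε / 2 := by positivity
  set δ := ε / 2 with hδe
  set K : ℝ := 1 + 2 * (2 / 3 * δ) ^ (-D⁻¹) with hK
  have hlim : Tendsto (fun x : ℝ => x ^ (-D) * K) atTop (𝓝 0) := by
    simpa using (tendsto_rpow_neg_atTop hD0).mul_const K
  obtain ⟨N, hN⟩ := eventually_atTop.1 ((hlim.eventually (gt_mem_nhds hδ)).and
    (eventually_gt_atTop 0))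
  refine ⟨N, fun x hxN => ?_⟩
  obtain ⟨h1, hx⟩ := hN x hxN
  have hxD := Real.rpow_pos_of_pos hx D
  have hpos : 0 < δ * x ^ D := by positivity
  -- With `J = ⌈δ x^D⌉` the initial cells cost at most `δ x^D + 1`, while `x J^(-1/D)` stays bounded
  -- for fixed `δ`; the constant `K` collects the bounded part.
  have hJ : 1 ≤ ⌈δ * x ^ D⌉₊ := Nat.ceil_pos.2 hpos
  have key := abs_fractSum_modelString_sub_le hD0 hD1 hs hz hx hJ
  rw [hκ', Complex.ofReal_re] at key
  have hJ1 : (⌈δ * x ^ D⌉₊ : ℝ) < δ * x ^ D + 1 := Nat.ceil_lt_add_one hpos.le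
  have hJ2 : (2 / 3 * (⌈δ * x ^ D⌉₊ : ℝ)) ^ (-D⁻¹) ≤ (2 / 3 * δ) ^ (-D⁻¹) * x⁻¹ := by
    have e : (2 / 3 * δ) ^ (-D⁻¹) * x⁻¹ = (2 / 3 * (δ * x ^ D)) ^ (-D⁻¹) := by
      rw [← mul_assoc, Real.mul_rpow (by positivity) hxD.le, ← Real.rpow_mul hx.le, mul_neg,
        mul_inv_cancel₀ hD0.ne', Real.rpow_neg_one]
    rw [e]
    refine Real.rpow_le_rpow_of_nonpos (by positivity) ?_ (neg_nonpos.2 (inv_pos.2 hD0).le)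
    exact mul_le_mul_of_nonneg_left (Nat.le_ceil _) (by norm_num)
  have hb : |(modelString hD0 hD1 hs).fractSum x - D * x ^ D * κ| ≤ δ * x ^ D + K := by
    have h2 : x * (2 / 3 * (⌈δ * x ^ D⌉₊ : ℝ)) ^ (-D⁻¹) ≤ (2 / 3 * δ) ^ (-D⁻¹) := by
      calc _ ≤ x * ((2 / 3 * δ) ^ (-D⁻¹) * x⁻¹) := mul_le_mul_of_nonneg_left hJ2 hx.le
        _ = _ := by field_simp
    rw [hK]
    linarith
  have e : x ^ (-D) * (modelString hD0 hD1 hs).fractSum x - D * κ =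
      x ^ (-D) * ((modelString hD0 hD1 hs).fractSum x - D * x ^ D * κ) := by
    rw [Real.rpow_neg hx.le]; field_simp
  rw [Real.dist_eq, e, abs_mul, abs_of_pos (Real.rpow_pos_of_pos hx _)]
  calc _ ≤ x ^ (-D) * (δ * x ^ D + K) := mul_le_mul_of_nonneg_left hb (by positivity)
    _ = δ + x ^ (-D) * K := by rw [mul_add, Real.rpow_neg hx.le]; field_simp
    _ < δ + δ := by linarith
    _ = ε := add_halves ε

/-- The oscillation is at most half of the main term `(1-D)⁻¹ x^D`, because `D ≤ |s|` and `1 - D ≤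
|1 - s|`. Hence `truncSum` is of exact order `x^D` and the dimension is `D`. -/
theorem abs_model_oscillation_le (hD0 : 0 < D) (hD1 : D < 1) (hs : s.re = D) {x : ℝ}
    (hx : 0 < x) :
    |D / (2 * ‖s‖) * ((x : ℂ) ^ s * (1 - s)⁻¹).re| ≤ (1 - D)⁻¹ / 2 * x ^ D := by
  have hDs : D ≤ ‖s‖ := hs ▸ Complex.re_le_norm s
  have hs0 : 0 < ‖s‖ := hD0.trans_le hDs
  have h1D := sub_pos.2 hD1
  have h1 : 1 - D ≤ ‖1 - s‖ := by
    have := Complex.re_le_norm (1 - s)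
    rwa [Complex.sub_re, hs, Complex.one_re] at this
  have h2 : |((x : ℂ) ^ s * (1 - s)⁻¹).re| ≤ x ^ D * (1 - D)⁻¹ := by
    refine (Complex.abs_re_le_norm _).trans ?_
    rw [norm_mul, Complex.norm_cpow_eq_rpow_re_of_pos hx, hs, norm_inv]
    exact mul_le_mul_of_nonneg_left (inv_anti₀ h1D h1) (by positivity)
  have h3 : D / (2 * ‖s‖) ≤ 1 / 2 := by
    rw [div_le_div_iff₀ (by positivity) two_pos]
    linarith
  rw [abs_mul, abs_of_pos (by positivity)]
  calc _ ≤ 1 / 2 * (x ^ D * (1 - D)⁻¹) := mul_le_mul h3 h2 (abs_nonneg _) (by norm_num)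
    _ = _ := by ring

theorem dimension_modelString (hD0 : 0 < D) (hD1 : D < 1) (hs : s.re = D) :
    (modelString hD0 hD1 hs).dimension = D := by
  have h1D : 0 < (1 - D)⁻¹ := inv_pos.2 (sub_pos.2 hD1)
  have hlarge : ∀ᶠ x : ℝ in atTop, 2 ≤ (1 - D)⁻¹ / 4 * x ^ D :=
    ((tendsto_rpow_atTop hD0).const_mul_atTop (by positivity)).eventually_ge_atTop 2
  have hb : ∀ᶠ x : ℝ in atTop, (1 - D)⁻¹ / 4 * x ^ D ≤ (modelString hD0 hD1 hs).truncSum x ∧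
      (modelString hD0 hD1 hs).truncSum x ≤ (2 * (1 - D)⁻¹) * x ^ D := by
    filter_upwards [hlarge, eventually_gt_atTop 0] with x hx hx0
    have h1 := abs_le.1 (abs_truncSum_modelString_sub_le hD0 hD1 hs hx0)
    have h2 := abs_le.1 (abs_model_oscillation_le hD0 hD1 hs hx0)
    constructor <;> nlinarith [h1.1, h1.2, h2.1, h2.2]
  exact dimension_eq_of_bounds _ hD0.le (by positivity : 0 < (1 - D)⁻¹ / 4)
    (hb.mono fun _ h => h.1) (hb.mono fun _ h => h.2)

/-- Measurability would give `x^(-D) truncSum x` a limit. Removing the main term and putting `x =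
e^t` would give a limit to the real part of `e^(i t im s) (1-s)⁻¹`, which oscillates. -/
theorem not_minkowskiMeasurable_modelString (hD0 : 0 < D) (hD1 : D < 1) (hs : s.re = D)
    (him : s.im ≠ 0) : ¬ (modelString hD0 hD1 hs).MinkowskiMeasurable := by
  intro h
  obtain ⟨c, hc⟩ := h.exists_tendsto
  rw [dimension_modelString hD0 hD1 hs] at hc
  have hs1 : 1 - s ≠ 0 := by
    rw [sub_ne_zero]; rintro rfl; rw [Complex.one_re] at hs; exact hD1.ne hs.symm
  have ha : 0 < D / (2 * ‖s‖) := by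
    have : 0 < ‖s‖ := hD0.trans_le (hs ▸ Complex.re_le_norm s)
    positivity
  set a := D / (2 * ‖s‖) with hae
  have herr : Tendsto (fun x : ℝ => x ^ (-D) * (modelString hD0 hD1 hs).truncSum x -
      x ^ (-D) * ((1 - D)⁻¹ * x ^ D + a * ((x : ℂ) ^ s * (1 - s)⁻¹).re)) atTop (𝓝 0) := by
    refine squeeze_zero_norm' (a := fun x : ℝ => x ^ (-D) * 2) ?_ (by
      simpa using (tendsto_rpow_neg_atTop hD0).mul_const 2)
    filter_upwards [eventually_gt_atTop 0] with x hx
    rw [← mul_sub, norm_mul, Real.norm_of_nonneg (Real.rpow_nonneg hx.le _)]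
    exact mul_le_mul_of_nonneg_left (abs_truncSum_modelString_sub_le hD0 hD1 hs hx) (by positivity)
  have h2 := (((hc.sub herr).sub_const (1 - D)⁻¹).const_mul a⁻¹).comp Real.tendsto_exp_atTop
  refine not_tendsto_re_exp_mul him (inv_ne_zero hs1) _ (h2.congr fun t => ?_)
  have hx := Real.exp_pos t
  have e : ((Real.exp t : ℝ) : ℂ) ^ s =
      ((Real.exp t ^ D : ℝ) : ℂ) * Complex.exp (s.im * t * Complex.I) := by
    rw [Complex.cpow_def_of_ne_zero (by exact_mod_cast hx.ne'), ← Complex.ofReal_log hx.le,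
      Real.log_exp, ← Real.exp_mul, Complex.ofReal_exp, ← Complex.exp_add]
    congr 1
    nth_rewrite 1 [← Complex.re_add_im s]
    rw [hs]
    push_cast
    ring
  have hxD := Real.rpow_pos_of_pos hx D
  simp only [Function.comp_apply, sub_sub_cancel]
  rw [e, mul_assoc, Complex.re_ofReal_mul, Real.rpow_neg hx.le]
  field_simp
  ring

end Model

end FractalString

theorem not_inverseSpectralProblem_of_riemannZeta_eq_zero {D : ℝ} (hD0 : 0 < D) (hD1 : D < 1)
    {s : ℂ} (hs : s.re = D) (hz : riemannZeta s = 0) : ¬ InverseSpectralProblem D := by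
  intro h
  have him : s.im ≠ 0 := by
    intro him
    have : s = D := Complex.ext (by simpa) (by simpa)
    rw [this] at hz
    exact (riemannZeta_ne_zero_of_mem_Ioo hD0 hD1).1 hz
  exact FractalString.not_minkowskiMeasurable_modelString hD0 hD1 hs him
    (h _ (FractalString.dimension_modelString hD0 hD1 hs)
      (FractalString.hasMonotonicSecondTerm_modelString hD0 hD1 hs hz))

end

theorem theorem6p1 (D : ℝ) (hD0 : 0 < D) (hD1 : D < 1) :
    InverseSpectralProblem D ↔ ∀ s : ℂ, s.re = D → riemannZeta s ≠ 0 :=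
  ⟨fun h _ hs hz => not_inverseSpectralProblem_of_riemannZeta_eq_zero hD0 hD1 hs hz h,
    inverseSpectralProblem_of_riemannZeta_ne_zero hD0 hD1⟩
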